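/- Let $n$ be a natural number and let $\mathbb{C}\{x\}$, $x=(x_1,\dots,x_n)$, be the ring of convergent power series at $0\in\mathbb{C}^n$. Let $f,g\in\mathbb{C}\{x\}$ be nonzero and without common irreducible factors, and put $\varphi=f/g$. Write $f=u\,f_1^{n_1}\cdots f_\alpha^{n_\alpha}$ and $g=v\,g_1^{m_1}\cdots g_\beta^{m_\beta}$ with $u,v$ units, $f_i$ (respectively $g_j$) irreducible and pairwise non-associated, and $n_i,m_j\ge 1$; put $f^{\mathrm{red}}=f_1\cdots f_\alpha$ and $g^{\mathrm{red}}=g_1\cdots g_\beta$, and let $$\theta_\varphi=f^{\mathrm{red}}g^{\mathrm{red}}\,\frac{d\varphi}{\varphi}=\frac{f^{\mathrm{red}}g^{\mathrm{red}}}{fg}\,(g\,df-f\,dg),$$ a germ of holomorphic $1$-form at $0\in\mathbb{C}^n$. Let $\mathrm{Sing}(\theta_\varphi)$ be the germ at $0$ of the common zero set of the coefficients of $\theta_\varphi$. For $h\in\mathbb{C}\{x\}$ irreducible and $\ell\ge 1$, say that $h$ is the equation of a (codimension-one) irreducible component of $\mathrm{Sing}(\theta_\varphi)$ of multiplicity $\ell$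 if the germ $\{h=0\}$ is an irreducible component of the analytic germ $\mathrm{Sing}(\theta_\varphi)$, $h^{\ell}$ divides $\theta_\varphi$ (that is, all its coefficients), and $h^{\ell+1}$ does not divide $\theta_\varphi$. Then, for every irreducible $h\in\mathbb{C}\{x\}$ and every integer $\ell\ge 1$, $h$ is the equation of a component of $\mathrm{Sing}(\theta_\varphi)$ of multiplicity $\ell$ if and only if there exists $c\in\mathbb{C}^*$ such that $h^{\ell+1}$ divides $f-cg$ and $h^{\ell+2}$ does not. -/

import Mathlib

open Filter Topology

noncomputable section

namespace ConvSeries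

/-- Absolute convergence of a formal power series on some polydisc around `0`. -/
def Convergent {n : ℕ} (f : MvPowerSeries (Fin n) ℂ) : Prop :=
  ∃ r : ℝ, 0 < r ∧ Summable fun m : Fin n →₀ ℕ => ‖MvPowerSeries.coeff m f‖ * r ^ m.degree

theorem Convergent.anti {n : ℕ} {f : MvPowerSeries (Fin n) ℂ} {r s : ℝ} (hs : 0 ≤ s)
    (hsr : s ≤ r)
    (h : Summable fun m : Fin n →₀ ℕ => ‖MvPowerSeries.coeff m f‖ * r ^ m.degree) :
    Summable fun m : Fin n →₀ ℕ => ‖MvPowerSeries.coeff m f‖ * s ^ m.degree :=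
  Summable.of_nonneg_of_le (fun m => by positivity) (fun m => by gcongr) h

theorem Convergent.add {n : ℕ} {f g : MvPowerSeries (Fin n) ℂ} (hf : Convergent f)
    (hg : Convergent g) : Convergent (f + g) := by
  obtain ⟨r, hr, hf⟩ := hf
  obtain ⟨s, hs, hg⟩ := hg
  have ht : 0 < min r s := lt_min hr hs
  refine ⟨min r s, ht, Summable.of_nonneg_of_le (fun m => by positivity) (fun m => ?_)
    ((Convergent.anti ht.le (min_le_left r s) hf).add
      (Convergent.anti ht.le (min_le_right r s) hg))⟩
  rw [map_add, ← add_mul]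
  exact mul_le_mul_of_nonneg_right (norm_add_le _ _) (by positivity)

theorem Convergent.mul {n : ℕ} {f g : MvPowerSeries (Fin n) ℂ} (hf : Convergent f)
    (hg : Convergent g) : Convergent (f * g) := by
  obtain ⟨r, hr, hf⟩ := hf
  obtain ⟨s, hs, hg⟩ := hg
  have ht : 0 < min r s := lt_min hr hs
  have hf' := Convergent.anti ht.le (min_le_left r s) hf
  have hg' := Convergent.anti ht.le (min_le_right r s) hg
  generalize min r s = t at ht hf' hg'
  let a : (Fin n →₀ ℕ) → ℝ := fun m => ‖MvPowerSeries.coeff m f‖ * t ^ m.degree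
  let b : (Fin n →₀ ℕ) → ℝ := fun m => ‖MvPowerSeries.coeff m g‖ * t ^ m.degree
  have ha : 0 ≤ a := fun m => by positivity
  have hb : 0 ≤ b := fun m => by positivity
  have hab : Summable fun x : (Fin n →₀ ℕ) × (Fin n →₀ ℕ) => a x.1 * b x.2 :=
    Summable.mul_of_nonneg hf' hg' ha hb
  refine ⟨t, ht, Summable.of_nonneg_of_le (fun m => by positivity) (fun m => ?_)
    (summable_sum_mul_antidiagonal_of_summable_mul hab)⟩
  rw [MvPowerSeries.coeff_mul]
  refine (mul_le_mul_of_nonneg_right (norm_sum_le _ _) (by positivity)).trans ?_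
  rw [Finset.sum_mul]
  refine Finset.sum_le_sum fun p hp => le_of_eq ?_
  rw [← Finset.HasAntidiagonal.mem_antidiagonal.1 hp, map_add, pow_add, norm_mul]
  simp only [a, b]
  ring

theorem Convergent.const {n : ℕ} (c : ℂ) :
    Convergent (algebraMap ℂ (MvPowerSeries (Fin n) ℂ) c) := by
  classical
  refine ⟨1, one_pos, summable_of_ne_finset_zero (s := {0}) fun m hm => ?_⟩
  rw [MvPowerSeries.algebraMap_apply, MvPowerSeries.coeff_C, if_neg (by simpa using hm)]
  simp

theorem Convergent.pderiv {n : ℕ} {f : MvPowerSeries (Fin n) ℂ} (hf : Convergent f)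
    (k : Fin n) : Convergent (MvPowerSeries.pderiv ℂ k f) := by
  obtain ⟨r, hr, hf⟩ := hf
  have hinj : Function.Injective fun m : Fin n →₀ ℕ => m + Finsupp.single k 1 :=
    add_left_injective _
  refine ⟨r / 2, by positivity, Summable.of_nonneg_of_le (fun m => by positivity) (fun m => ?_)
    ((hf.comp_injective hinj).mul_left r⁻¹)⟩
  have h1 : m k + 1 ≤ 2 ^ m.degree :=
    (Nat.lt_two_pow_self (n := m k)).trans_le
      (Nat.pow_le_pow_right two_pos (Finsupp.le_degree k m))
  have h2 : ((m k : ℝ) + 1) ≤ 2 ^ m.degree := by exact_mod_cast h1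
  have h3 : ‖((m k : ℂ) + 1)‖ = (m k : ℝ) + 1 := by
    have : ((m k : ℂ) + 1) = ((m k + 1 : ℕ) : ℂ) := by push_cast; ring
    rw [this, Complex.norm_natCast]; push_cast; ring
  have h4 : ((m k : ℝ) + 1) * (r / 2) ^ m.degree ≤ r ^ m.degree := by
    rw [div_pow, mul_div_assoc', div_le_iff₀ (by positivity), mul_comm (r ^ _)]
    gcongr
  simp only [Function.comp]
  rw [MvPowerSeries.coeff_pderiv, norm_mul, h3, map_add, Finsupp.degree_single, pow_succ]
  calc _ = ‖MvPowerSeries.coeff (m + Finsupp.single k 1) f‖ *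
          (((m k : ℝ) + 1) * (r / 2) ^ m.degree) := by ring
    _ ≤ ‖MvPowerSeries.coeff (m + Finsupp.single k 1) f‖ * r ^ m.degree := by gcongr
    _ = _ := by field_simp

/-- The ring `ℂ{x}`, `x = (x₁, …, xₙ)`, of convergent power series. -/
def convSeries (n : ℕ) : Subalgebra ℂ (MvPowerSeries (Fin n) ℂ) where
  carrier := {f | Convergent f}
  add_mem' := Convergent.add
  mul_mem' := Convergent.mul
  algebraMap_mem' := Convergent.const

/-- The partial derivative `∂/∂xₖ` on `ℂ{x}`. -/
def pd {n : ℕ} (k : Fin n) : Derivation ℂ (convSeries n) (convSeries n) where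
  toFun f := ⟨MvPowerSeries.pderiv ℂ k f, Convergent.pderiv f.2 k⟩
  map_add' _ _ := Subtype.ext (map_add (MvPowerSeries.pderiv ℂ k) _ _)
  map_smul' c _ := Subtype.ext ((MvPowerSeries.pderiv ℂ k).map_smul c _)
  map_one_eq_zero' := Subtype.ext (MvPowerSeries.pderiv ℂ k).map_one_eq_zero
  leibniz' _ _ := Subtype.ext ((MvPowerSeries.pderiv ℂ k).leibniz _ _)

/-- The value of a convergent power series at `z`. It is the sum of the series for `z` in a
neighbourhood of `0`; only such `z` matter below. -/
def value {n : ℕ} (f : convSeries n) (z : Fin n → ℂ) : ℂ :=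
  ∑' m : Fin n →₀ ℕ, MvPowerSeries.coeff m (f : MvPowerSeries (Fin n) ℂ) * m.prod (z · ^ ·)

/-! ### Germs of analytic sets at the origin

A germ is represented by a subset of `ℂⁿ`, and germs are compared by `=ᶠ[𝓝 0]` and `≤ᶠ[𝓝 0]`. -/

/-- The common zeros of a set of convergent power series. -/
def zeros {n : ℕ} (S : Set (convSeries n)) : Set (Fin n → ℂ) :=
  {z | ∀ a ∈ S, value a z = 0}

/-- `X` represents the germ at `0` of an analytic set. -/
def IsAnalyticGerm {n : ℕ} (X : Set (Fin n → ℂ)) : Prop :=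
  ∃ S : Set (convSeries n), S.Finite ∧ X =ᶠ[𝓝 0] zeros S

/-- `X` represents an irreducible germ of analytic set at `0`. -/
def IsIrreducibleGerm {n : ℕ} (X : Set (Fin n → ℂ)) : Prop :=
  IsAnalyticGerm X ∧ ¬ X =ᶠ[𝓝 0] (∅ : Set (Fin n → ℂ)) ∧
    ∀ Y Z : Set (Fin n → ℂ), IsAnalyticGerm Y → IsAnalyticGerm Z →
      X =ᶠ[𝓝 0] (Y ∪ Z : Set (Fin n → ℂ)) → X =ᶠ[𝓝 0] Y ∨ X =ᶠ[𝓝 0] Z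

/-- The germ `V` is an irreducible component of the germ `X`: a maximal irreducible germ of
analytic set contained in `X`. -/
def IsComponent {n : ℕ} (V X : Set (Fin n → ℂ)) : Prop :=
  IsIrreducibleGerm V ∧ V ≤ᶠ[𝓝 0] X ∧
    ∀ W : Set (Fin n → ℂ), IsIrreducibleGerm W → V ≤ᶠ[𝓝 0] W → W ≤ᶠ[𝓝 0] X → W =ᶠ[𝓝 0] V

/-! ### Holomorphic `1`-forms -/

/-- Germs at `0` of holomorphic `1`-forms `∑ₖ aₖ dxₖ`, given by their coefficients. -/
abbrev OneForm (n : ℕ) : Type := Fin n → convSeries n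

/-- The differential `df = ∑ₖ (∂f/∂xₖ) dxₖ`. -/
def diff {n : ℕ} (f : convSeries n) : OneForm n := fun k => pd k f

/-- The singular set of a `1`-form: the common zeros of its coefficients. -/
def sing {n : ℕ} (ω : OneForm n) : Set (Fin n → ℂ) := zeros (Set.range ω)

/-- `a` divides the `1`-form `ω`. -/
def DividesForm {n : ℕ} (a : convSeries n) (ω : OneForm n) : Prop :=
  ∃ η : OneForm n, ω = a • η

/-- `h` is an irreducible equation of a codimension one component of `Sing(ω)`, and this component
has multiplicity `ℓ`. -/
def IsSingComponent {n : ℕ} (ω : OneForm n) (h : convSeries n) (ℓ : ℕ) : Prop :=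
  Irreducible h ∧ IsComponent (zeros {h}) (sing ω) ∧
    DividesForm (h ^ ℓ) ω ∧ ¬ DividesForm (h ^ (ℓ + 1)) ω

/-- A decomposition `f = u f₁^{n₁} ⋯ f_α^{n_α}` in irreducible factors, with `u` a unit, the `fᵢ`
pairwise non-associated and the `nᵢ` positive. -/
structure Decomposition {n : ℕ} (f : convSeries n) where
  len : ℕ
  unit : (convSeries n)ˣ
  factor : Fin len → convSeries n
  exponent : Fin len → ℕ
  irreducible : ∀ i, Irreducible (factor i)
  not_associated : ∀ i j, i ≠ j → ¬ Associated (factor i) (factor j)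
  exponent_pos : ∀ i, 0 < exponent i
  eq_prod : f = unit * ∏ i, factor i ^ exponent i

/-- The reduced equation `f₁ ⋯ f_α` of `f = 0`. -/
def Decomposition.red {n : ℕ} {f : convSeries n} (D : Decomposition f) : convSeries n :=
  ∏ i, D.factor i

/-- The holomorphic `1`-form `f^red (df / f)`, which is
`f^red u⁻¹ du + ∑ᵢ nᵢ f₁ ⋯ (omit fᵢ) ⋯ f_α dfᵢ`. -/
def Decomposition.redLogDiff {n : ℕ} {f : convSeries n} (D : Decomposition f) : OneForm n :=
  (D.red * (D.unit⁻¹ : (convSeries n)ˣ)) • diff (D.unit : convSeries n) +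
    ∑ i, ((D.exponent i : convSeries n) * ∏ j ∈ Finset.univ.erase i, D.factor j) •
      diff (D.factor i)

/-- The holomorphic `1`-form `θ_φ = f^red g^red (dφ / φ)` of `φ = f / g`, where
`dφ / φ = df / f - dg / g`. -/
def theta {n : ℕ} {f g : convSeries n} (Df : Decomposition f) (Dg : Decomposition g) : OneForm n :=
  Dg.red • Df.redLogDiff - Df.red • Dg.redLogDiff

theorem pd_prod_pow {n : ℕ} (k : Fin n) {ι : Type} [DecidableEq ι] (p : ι → convSeries n)
    (e : ι → ℕ) (he : ∀ i, 0 < e i) (s : Finset ι) :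
    (∏ i ∈ s, p i) * pd k (∏ i ∈ s, p i ^ e i) =
      (∏ i ∈ s, p i ^ e i) * ∑ i ∈ s, (e i : convSeries n) * (∏ j ∈ s.erase i, p j) * pd k (p i) := by
  induction s using Finset.induction_on with
  | empty => simp
  | insert a s ha ih =>
    have h1 : ∑ i ∈ s, (e i : convSeries n) * (∏ j ∈ (insert a s).erase i, p j) * pd k (p i) =
        p a * ∑ i ∈ s, (e i : convSeries n) * (∏ j ∈ s.erase i, p j) * pd k (p i) := by
      rw [Finset.mul_sum]
      refine Finset.sum_congr rfl fun i hi => ?_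
      have hia : a ≠ i := fun h => ha (h ▸ hi)
      rw [Finset.erase_insert_of_ne hia, Finset.prod_insert (by simp [ha])]
      ring
    obtain ⟨d, hd⟩ : ∃ d, e a = d + 1 := ⟨e a - 1, by have := he a; omega⟩
    rw [Finset.prod_insert ha, Finset.prod_insert ha, Finset.sum_insert ha, h1,
      Finset.erase_insert ha, Derivation.leibniz, Derivation.leibniz_pow, hd]
    simp only [smul_eq_mul, nsmul_eq_mul, Nat.add_sub_cancel]
    linear_combination (p a ^ (d + 2)) * ih

/-- `f · redLogDiff = f^red · df`. -/
theorem Decomposition.mul_redLogDiff {n : ℕ} {f : convSeries n} (D : Decomposition f) :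
    f • D.redLogDiff = D.red • diff f := by
  funext k
  have h := pd_prod_pow k D.factor D.exponent D.exponent_pos Finset.univ
  have hu : (D.unit : convSeries n) * (D.unit⁻¹ : (convSeries n)ˣ) = 1 := D.unit.mul_inv
  have hf := D.eq_prod
  have hd : pd k f = (D.unit : convSeries n) * pd k (∏ i, D.factor i ^ D.exponent i) +
      (∏ i, D.factor i ^ D.exponent i) * pd k (D.unit : convSeries n) := by
    conv_lhs => rw [hf]
    rw [Derivation.leibniz]; rfl
  simp only [redLogDiff, red, diff, Pi.smul_apply, Pi.add_apply, Finset.sum_apply, smul_eq_mul,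
    hd] at h ⊢
  generalize (∑ i, (D.exponent i : convSeries n) *
    (∏ j ∈ Finset.univ.erase i, D.factor j) * pd k (D.factor i)) = T at *
  generalize pd k (∏ i, D.factor i ^ D.exponent i) = Q at *
  generalize (∏ i, D.factor i ^ D.exponent i) = P at *
  generalize (∏ i, D.factor i) = F at *
  linear_combination (F * (D.unit⁻¹ : (convSeries n)ˣ) * pd k (D.unit : convSeries n) + T) * hf -
    (D.unit : convSeries n) * h + P * F * pd k (D.unit : convSeries n) * hu

/-- `θ_φ = (f^red g^red / (f g)) (g df - f dg)`, so `theta` is indeed `f^red g^red (dφ / φ)`. -/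
theorem mul_theta {n : ℕ} {f g : convSeries n} (Df : Decomposition f) (Dg : Decomposition g) :
    (f * g) • theta Df Dg = (Df.red * Dg.red) • (g • diff f - f • diff g) := by
  have h1 := Df.mul_redLogDiff
  have h2 := Dg.mul_redLogDiff
  funext k
  have h1k := congrFun h1 k
  have h2k := congrFun h2 k
  simp only [theta, Pi.smul_apply, Pi.sub_apply, smul_eq_mul] at h1k h2k ⊢
  linear_combination g * Dg.red * h1k - f * Df.red * h2k

end ConvSeries

end

/-!
The form `θ_φ` is not divisible by an irreducible factor `h` of `f g`, since modulo a factor `fᵢ`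
of `f` it is `nᵢ g^red f₁ ⋯ (omit fᵢ) ⋯ f_α dfᵢ`. For every other irreducible `h`, `θ_φ` is
divisible by the same powers of `h` as the Wronskian `g df - f dg`. If `h` divides the Wronskian,
then `f / g` is constant on `{h = 0}`: after a linear change of coordinates, Weierstrass
preparation makes `f / g` algebraic over power series in one variable less, and the coefficients of
its minimal polynomial are killed by all derivations, hence constant. So `h ∣ f - c g` for some `c`,
and `f - c g = h ^ (j + 1) e` gives
`g df - f dg = h ^ j ((j + 1) g e dh + h (g de - e dg))`, where `h ∤ (j + 1) g e dh` if `h ∤ e`.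
By the Nullstellensatz for hypersurface germs, the ideal of `{h = 0}` is the height one prime `(h)`,
so `{h = 0}` is a component of `Sing θ_φ` as soon as `h` divides `θ_φ ≠ 0`.
-/

noncomputable section

namespace ConvSeries

open MvPowerSeries
open scoped ENNReal

/-! ### Weighted norms and absolute convergence -/

section wnorm

variable {σ τ 𝕜 : Type*} [NormedField 𝕜] {w v : σ → ℝ≥0∞} {f g : MvPowerSeries σ 𝕜}

/-- The weight `∏ᵢ wᵢ ^ mᵢ` of the monomial `x ^ m`, for weights `wᵢ` of the variables. -/
def monomialWeight (w : σ → ℝ≥0∞) (m : σ →₀ ℕ) : ℝ≥0∞ := m.prod fun i k => w i ^ k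

/-- The weighted `ℓ¹` norm `∑ₘ ‖aₘ‖ w ^ m` of a power series `∑ₘ aₘ x ^ m`. Finiteness for a
positive weight `w` expresses absolute convergence on the polydisc of polyradius `w`; with values in
`ℝ≥0∞` no summability side conditions arise. -/
def wnorm (w : σ → ℝ≥0∞) (f : MvPowerSeries σ 𝕜) : ℝ≥0∞ :=
  ∑' m : σ →₀ ℕ, ‖coeff m f‖ₑ * monomialWeight w m

@[simp] theorem monomialWeight_zero (w : σ → ℝ≥0∞) : monomialWeight w 0 = 1 :=
  Finsupp.prod_zero_index

theorem monomialWeight_add (w : σ → ℝ≥0∞) (a b : σ →₀ ℕ) :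
    monomialWeight w (a + b) = monomialWeight w a * monomialWeight w b := by
  classical exact Finsupp.prod_add_index' (by simp) fun _ _ _ => pow_add _ _ _

theorem monomialWeight_single (w : σ → ℝ≥0∞) (i : σ) (k : ℕ) :
    monomialWeight w (Finsupp.single i k) = w i ^ k :=
  Finsupp.prod_single_index (pow_zero _)

theorem monomialWeight_mono (h : ∀ i, w i ≤ v i) (m : σ →₀ ℕ) :
    monomialWeight w m ≤ monomialWeight v m :=
  Finset.prod_le_prod' fun i _ => pow_le_pow_left' (h i) _

theorem monomialWeight_ne_zero (h : ∀ i, w i ≠ 0) (m : σ →₀ ℕ) : monomialWeight w m ≠ 0 :=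
  Finset.prod_ne_zero_iff.2 fun i _ => pow_ne_zero _ (h i)

theorem monomialWeight_ne_top (h : ∀ i, w i ≠ ⊤) (m : σ →₀ ℕ) : monomialWeight w m ≠ ⊤ :=
  ENNReal.prod_ne_top fun i _ => ENNReal.pow_ne_top (h i)

theorem wnorm_mono (h : ∀ i, w i ≤ v i) (f : MvPowerSeries σ 𝕜) : wnorm w f ≤ wnorm v f :=
  ENNReal.tsum_le_tsum fun m => mul_le_mul_right (monomialWeight_mono h m) _

theorem enorm_coeff_mul_monomialWeight_le_wnorm (w : σ → ℝ≥0∞) (f : MvPowerSeries σ 𝕜)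
    (m : σ →₀ ℕ) : ‖coeff m f‖ₑ * monomialWeight w m ≤ wnorm w f :=
  ENNReal.le_tsum m

theorem wnorm_zero (w : σ → ℝ≥0∞) : wnorm w (0 : MvPowerSeries σ 𝕜) = 0 := by simp [wnorm]

theorem wnorm_add_le (w : σ → ℝ≥0∞) (f g : MvPowerSeries σ 𝕜) :
    wnorm w (f + g) ≤ wnorm w f + wnorm w g := by
  rw [wnorm, wnorm, wnorm, ← ENNReal.tsum_add]
  refine ENNReal.tsum_le_tsum fun m => ?_
  rw [map_add, ← add_mul]
  gcongr
  exact enorm_add_le _ _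

theorem wnorm_sum_le {ι : Type*} (w : σ → ℝ≥0∞) (s : Finset ι) (f : ι → MvPowerSeries σ 𝕜) :
    wnorm w (∑ i ∈ s, f i) ≤ ∑ i ∈ s, wnorm w (f i) :=
  Finset.le_sum_of_subadditive _ (wnorm_zero w).le (wnorm_add_le w) s f

theorem wnorm_monomial (w : σ → ℝ≥0∞) (m : σ →₀ ℕ) (c : 𝕜) :
    wnorm w (monomial m c) = ‖c‖ₑ * monomialWeight w m := by
  classical
  rw [wnorm, tsum_eq_single m fun b hb => by simp [coeff_monomial, hb], coeff_monomial_same]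

theorem wnorm_C (w : σ → ℝ≥0∞) (c : 𝕜) : wnorm w (C c) = ‖c‖ₑ := by
  rw [← monomial_zero_eq_C_apply, wnorm_monomial, monomialWeight_zero, mul_one]

theorem wnorm_one (w : σ → ℝ≥0∞) : wnorm w (1 : MvPowerSeries σ 𝕜) = 1 := by
  rw [← map_one C, wnorm_C, enorm_one]

theorem wnorm_X (w : σ → ℝ≥0∞) (i : σ) : wnorm w (X i : MvPowerSeries σ 𝕜) = w i := by
  rw [X_def, wnorm_monomial, monomialWeight_single, enorm_one, one_mul, pow_one]

theorem tsum_sum_antidiagonal_mul {M : Type*} [AddMonoid M] [Finset.HasAntidiagonal M]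
    (a b : M → ℝ≥0∞) :
    ∑' m, ∑ p ∈ Finset.HasAntidiagonal.antidiagonal m, a p.1 * b p.2 = (∑' m, a m) * ∑' m, b m := by
  rw [← ENNReal.tsum_mul_right]
  simp_rw [← ENNReal.tsum_mul_left]
  rw [← ENNReal.tsum_prod (f := fun x y => a x * b y),
    ← Finset.HasAntidiagonal.sigmaAntidiagonalEquivProd.tsum_eq, ENNReal.tsum_sigma']
  refine tsum_congr fun m => ?_
  rw [tsum_fintype, Finset.univ_eq_attach, ← Finset.sum_attach]
  rfl

theorem wnorm_mul_le (w : σ → ℝ≥0∞) (f g : MvPowerSeries σ 𝕜) :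
    wnorm w (f * g) ≤ wnorm w f * wnorm w g := by
  classical
  rw [wnorm, wnorm, wnorm, ← tsum_sum_antidiagonal_mul]
  refine ENNReal.tsum_le_tsum fun m => ?_
  calc ‖coeff m (f * g)‖ₑ * monomialWeight w m
      ≤ (∑ p ∈ Finset.HasAntidiagonal.antidiagonal m, ‖coeff p.1 f * coeff p.2 g‖ₑ) *
          monomialWeight w m := by
        rw [coeff_mul]
        gcongr
        exact enorm_sum_le _ _
    _ = ∑ p ∈ Finset.HasAntidiagonal.antidiagonal m,
          ‖coeff p.1 f‖ₑ * monomialWeight w p.1 * (‖coeff p.2 g‖ₑ * monomialWeight w p.2) := by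
        rw [Finset.sum_mul]
        refine Finset.sum_congr rfl fun p hp => ?_
        rw [← Finset.HasAntidiagonal.mem_antidiagonal.1 hp, monomialWeight_add, enorm_mul]
        ring

theorem wnorm_prod_le {ι : Type*} (w : σ → ℝ≥0∞) (s : Finset ι) (f : ι → MvPowerSeries σ 𝕜) :
    wnorm w (∏ i ∈ s, f i) ≤ ∏ i ∈ s, wnorm w (f i) :=
  Finset.le_prod_of_submultiplicative _ (wnorm_one w).le (wnorm_mul_le w) s f

theorem wnorm_pow_le (w : σ → ℝ≥0∞) (f : MvPowerSeries σ 𝕜) (k : ℕ) :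
    wnorm w (f ^ k) ≤ wnorm w f ^ k := by
  simpa only [Finset.prod_const, Finset.card_range] using
    wnorm_prod_le w (Finset.range k) fun _ => f

theorem wnorm_le_mul_wnorm {t : ℝ≥0∞} (hvw : ∀ i, v i ≤ w i)
    (hf : ∀ m, coeff m f ≠ 0 → ∃ i, m i ≠ 0 ∧ v i ≤ t * w i) : wnorm v f ≤ t * wnorm w f := by
  rw [wnorm, wnorm, ← ENNReal.tsum_mul_left]
  refine ENNReal.tsum_le_tsum fun m => ?_
  rcases eq_or_ne (coeff m f) 0 with hm | hm
  · simp [hm]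
  obtain ⟨i, hmi, hi⟩ := hf m hm
  obtain ⟨m', rfl⟩ := exists_add_of_le (Finsupp.single_le_iff.2 (Nat.one_le_iff_ne_zero.2 hmi))
  have hmono := monomialWeight_mono hvw m'
  simp only [monomialWeight_add, monomialWeight_single, pow_one]
  calc ‖coeff (Finsupp.single i 1 + m') f‖ₑ * (v i * monomialWeight v m')
      ≤ ‖coeff (Finsupp.single i 1 + m') f‖ₑ * (t * w i * monomialWeight w m') := by gcongr
    _ = t * (‖coeff (Finsupp.single i 1 + m') f‖ₑ * (w i * monomialWeight w m')) := by ring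

theorem eq_zero_of_wnorm_eq_zero (hw : ∀ i, w i ≠ 0) (h : wnorm w f = 0) : f = 0 := by
  ext m
  simpa [monomialWeight_ne_zero hw m] using ENNReal.tsum_eq_zero.1 h m

theorem exists_wnorm_le_of_ne_top (hw : ∀ i, w i ≠ 0) (h : wnorm w f ≠ ⊤)
    (hf : constantCoeff f = 0) {ε : ℝ≥0∞} (hε : ε ≠ 0) :
    ∃ v : σ → ℝ≥0∞, (∀ i, v i ≠ 0) ∧ wnorm v f ≤ ε := by
  obtain ⟨t, ht0, ht⟩ := ENNReal.exists_nnreal_pos_mul_lt h hε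
  have hmin : min (t : ℝ≥0∞) 1 ≠ 0 := by simpa using ht0.ne'
  refine ⟨fun i => min (t : ℝ≥0∞) 1 * w i, fun i => mul_ne_zero hmin (hw i), ?_⟩
  have hle : wnorm (fun i => min (t : ℝ≥0∞) 1 * w i) f ≤ t * wnorm w f := by
    refine wnorm_le_mul_wnorm (fun i => mul_le_of_le_one_left' (min_le_right _ _)) fun m hm => ?_
    have hm0 : m ≠ 0 := by
      rintro rfl
      exact hm hf
    obtain ⟨i, hi⟩ := Finsupp.ne_iff.1 hm0
    exact ⟨i, hi, mul_le_mul_left (min_le_left _ _) _⟩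
  exact hle.trans ht.le

theorem coeff_subst_eq_tsum {a : σ → MvPowerSeries τ 𝕜} (ha : HasSubst a) (f : MvPowerSeries σ 𝕜)
    (e : τ →₀ ℕ) :
    coeff e (subst a f) = ∑' d : σ →₀ ℕ, coeff d f * coeff e (d.prod fun s k => a s ^ k) := by
  rw [coeff_subst ha, ← tsum_eq_finsum (L := .unconditional _) (coeff_subst_finite ha f e)]
  rfl

theorem tsum_tsum_enorm_subst_le (a : σ → MvPowerSeries τ 𝕜) (w : τ → ℝ≥0∞)
    (f : MvPowerSeries σ 𝕜) :
    ∑' (d : σ →₀ ℕ) (e : τ →₀ ℕ),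
      ‖coeff d f * coeff e (d.prod fun s k => a s ^ k)‖ₑ * monomialWeight w e ≤
        wnorm (fun i => wnorm w (a i)) f := by
  refine ENNReal.tsum_le_tsum fun d => ?_
  simp_rw [enorm_mul, mul_assoc, ENNReal.tsum_mul_left]
  gcongr
  calc wnorm w (d.prod fun s k => a s ^ k) ≤ d.prod fun s k => wnorm w (a s ^ k) :=
        wnorm_prod_le _ _ _
    _ ≤ monomialWeight (fun i => wnorm w (a i)) d :=
        Finset.prod_le_prod' fun i _ => wnorm_pow_le _ _ _

theorem wnorm_subst_le {a : σ → MvPowerSeries τ 𝕜} (ha : HasSubst a) (w : τ → ℝ≥0∞)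
    (f : MvPowerSeries σ 𝕜) : wnorm w (subst a f) ≤ wnorm (fun i => wnorm w (a i)) f := by
  refine le_trans ?_ (tsum_tsum_enorm_subst_le a w f)
  rw [ENNReal.tsum_comm]
  refine ENNReal.tsum_le_tsum fun e => ?_
  rw [ENNReal.tsum_mul_right, coeff_subst_eq_tsum ha]
  gcongr
  exact enorm_tsum_le_tsum_enorm

end wnorm

section convergent

variable {n p : ℕ} {f g : MvPowerSeries (Fin n) ℂ}

theorem exists_ofReal_le {ι : Type*} [Finite ι] {w : ι → ℝ≥0∞} (hw : ∀ i, w i ≠ 0) :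
    ∃ r : ℝ, 0 < r ∧ ∀ i, ENNReal.ofReal r ≤ w i := by
  have := Fintype.ofFinite ι
  have hpos : 0 < min (Finset.univ.inf w) 1 := by
    refine lt_min ?_ one_pos
    rw [Finset.lt_inf_iff (by simp)]
    exact fun i _ => pos_iff_ne_zero.2 (hw i)
  have htop : min (Finset.univ.inf w) 1 ≠ ⊤ :=
    ne_top_of_le_ne_top ENNReal.one_ne_top (min_le_right _ _)
  refine ⟨(min (Finset.univ.inf w) 1).toReal, ENNReal.toReal_pos hpos.ne' htop, fun i => ?_⟩
  rw [ENNReal.ofReal_toReal htop]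
  exact (min_le_left _ _).trans (Finset.inf_le (Finset.mem_univ i))

theorem summable_norm_mul_pow_degree_iff {σ 𝕜 : Type*} [NormedField 𝕜] {f : MvPowerSeries σ 𝕜}
    {r : ℝ} (hr : 0 ≤ r) :
    (Summable fun m : σ →₀ ℕ => ‖coeff m f‖ * r ^ m.degree) ↔
      wnorm (fun _ => ENNReal.ofReal r) f ≠ ⊤ := by
  have hwnorm : wnorm (fun _ => ENNReal.ofReal r) f =
      ∑' m : σ →₀ ℕ, ‖‖coeff m f‖ * r ^ m.degree‖ₑ := by
    refine tsum_congr fun m => ?_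
    rw [enorm_mul, enorm_norm, enorm_pow, Real.enorm_eq_ofReal hr, monomialWeight, Finsupp.prod,
      Finset.prod_pow_eq_pow_sum, Finsupp.degree_apply]
  rw [hwnorm, tsum_enorm_ne_top_iff_summable_norm]
  exact summable_congr fun m => (Real.norm_of_nonneg (by positivity)).symm

theorem convergent_iff :
    Convergent f ↔ ∃ w : Fin n → ℝ≥0∞, (∀ i, w i ≠ 0) ∧ wnorm w f ≠ ⊤ := by
  constructor
  · rintro ⟨r, hr, h⟩
    exact ⟨_, fun _ => by simpa using hr, (summable_norm_mul_pow_degree_iff hr.le).1 h⟩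
  · rintro ⟨w, hw, h⟩
    obtain ⟨r, hr, hrw⟩ := exists_ofReal_le hw
    exact ⟨r, hr, (summable_norm_mul_pow_degree_iff hr.le).2
      (ne_top_of_le_ne_top h (wnorm_mono hrw f))⟩

theorem Convergent.exists_wnorm_le (hf : Convergent f) (hf0 : constantCoeff f = 0) {ε : ℝ≥0∞}
    (hε : ε ≠ 0) : ∃ w : Fin n → ℝ≥0∞, (∀ i, w i ≠ 0) ∧ wnorm w f ≤ ε :=
  let ⟨_, hw, h⟩ := convergent_iff.1 hf
  exists_wnorm_le_of_ne_top hw h hf0 hε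

theorem Convergent.subst {a : Fin p → MvPowerSeries (Fin n) ℂ} (ha : ∀ i, Convergent (a i))
    (ha0 : ∀ i, constantCoeff (a i) = 0) {f : MvPowerSeries (Fin p) ℂ} (hf : Convergent f) :
    Convergent (subst a f) := by
  obtain ⟨v, hv, hfv⟩ := convergent_iff.1 hf
  choose w hw hwa using fun i => (ha i).exists_wnorm_le (ha0 i) (hv i)
  refine convergent_iff.2 ⟨fun j => Finset.univ.inf fun i => w i j, fun j => ?_, ?_⟩
  · rw [← pos_iff_ne_zero, Finset.lt_inf_iff (by simp)]
    exact fun i _ => pos_iff_ne_zero.2 (hw i j)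
  · have hle (i) : wnorm (fun j => Finset.univ.inf fun i => w i j) (a i) ≤ v i :=
      (wnorm_mono (fun j => Finset.inf_le (Finset.mem_univ i)) _).trans (hwa i)
    exact ne_top_of_le_ne_top hfv
      ((wnorm_subst_le (hasSubst_of_constantCoeff_zero ha0) _ f).trans (wnorm_mono hle f))

end convergent

section evaluation

variable {σ τ 𝕜 : Type*} [NormedField 𝕜] {z : σ → 𝕜}

/-- The sum `∑ₘ aₘ z ^ m` of the power series `∑ₘ aₘ x ^ m` at `z`. It is meaningful only for series
in `convergentAt z`. -/
def sumAt (f : MvPowerSeries σ 𝕜) (z : σ → 𝕜) : 𝕜 :=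
  ∑' m : σ →₀ ℕ, coeff m f * m.prod (z · ^ ·)

theorem prod_pow_add (z : σ → 𝕜) (m m' : σ →₀ ℕ) :
    (m + m').prod (z · ^ ·) = m.prod (z · ^ ·) * m'.prod (z · ^ ·) := by
  classical
  exact Finsupp.prod_add_index' (fun i => pow_zero (z i)) fun i => pow_add (z i)

theorem coeff_mul_mul_prod_pow [DecidableEq σ] (f g : MvPowerSeries σ 𝕜) (m : σ →₀ ℕ) :
    coeff m (f * g) * m.prod (z · ^ ·) =
      ∑ p ∈ Finset.HasAntidiagonal.antidiagonal m,
        coeff p.1 f * p.1.prod (z · ^ ·) * (coeff p.2 g * p.2.prod (z · ^ ·)) := by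
  rw [coeff_mul, Finset.sum_mul]
  refine Finset.sum_congr rfl fun p hp => ?_
  rw [← Finset.HasAntidiagonal.mem_antidiagonal.1 hp, prod_pow_add, mul_mul_mul_comm]

theorem enorm_monomial_eval (m : σ →₀ ℕ) (z : σ → 𝕜) :
    ‖m.prod (z · ^ ·)‖ₑ = monomialWeight (fun i => ‖z i‖ₑ) m := by
  simp [Finsupp.prod, monomialWeight, enorm_eq_nnnorm, nnnorm_prod]

theorem wnorm_enorm_eq_tsum (f : MvPowerSeries σ 𝕜) (z : σ → 𝕜) :
    wnorm (fun i => ‖z i‖ₑ) f = ∑' m : σ →₀ ℕ, ‖coeff m f * m.prod (z · ^ ·)‖ₑ :=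
  tsum_congr fun m => by rw [enorm_mul, enorm_monomial_eval]

/-- The algebra of the power series that converge absolutely at `z`. -/
def convergentAt (z : σ → 𝕜) : Subalgebra 𝕜 (MvPowerSeries σ 𝕜) where
  carrier := {f | wnorm (fun i => ‖z i‖ₑ) f ≠ ⊤}
  add_mem' hf hg := ne_top_of_le_ne_top (ENNReal.add_ne_top.2 ⟨hf, hg⟩) (wnorm_add_le _ _ _)
  mul_mem' hf hg := ne_top_of_le_ne_top (ENNReal.mul_ne_top hf hg) (wnorm_mul_le _ _ _)
  algebraMap_mem' c := by
    change wnorm _ (C c) ≠ ⊤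
    rw [wnorm_C]
    exact enorm_ne_top

theorem mem_convergentAt {f : MvPowerSeries σ 𝕜} :
    f ∈ convergentAt z ↔ wnorm (fun i => ‖z i‖ₑ) f ≠ ⊤ :=
  Iff.rfl

theorem summable_norm_of_mem_convergentAt {f : MvPowerSeries σ 𝕜} (h : f ∈ convergentAt z) :
    Summable fun m : σ →₀ ℕ => ‖coeff m f * m.prod (z · ^ ·)‖ := by
  rw [mem_convergentAt, wnorm_enorm_eq_tsum] at h
  exact tsum_enorm_ne_top_iff_summable_norm.1 h

theorem X_mem_convergentAt (i : σ) : X i ∈ convergentAt z := by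
  rw [mem_convergentAt, wnorm_X]
  exact enorm_ne_top

theorem sumAt_C (c : 𝕜) : sumAt (C c) z = c := by
  classical
  rw [sumAt, tsum_eq_single 0 fun m hm => by simp [coeff_C, hm]]
  simp

theorem sumAt_X (i : σ) : sumAt (X i) z = z i := by
  classical
  rw [sumAt, tsum_eq_single (Finsupp.single i 1) fun m hm => by simp [coeff_X, hm]]
  simp

theorem sumAt_zero_right (f : MvPowerSeries σ 𝕜) : sumAt f 0 = constantCoeff f := by
  rw [sumAt, tsum_eq_single 0]
  · simp
  · intro m hm
    obtain ⟨i, hi⟩ := Finsupp.ne_iff.1 hm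
    rw [Finsupp.prod, Finset.prod_eq_zero (Finsupp.mem_support_iff.2 hi), mul_zero]
    simpa using hi

variable [CompleteSpace 𝕜]

theorem sumAt_add {f g : MvPowerSeries σ 𝕜} (hf : f ∈ convergentAt z) (hg : g ∈ convergentAt z) :
    sumAt (f + g) z = sumAt f z + sumAt g z := by
  rw [sumAt, sumAt, sumAt, ← (summable_norm_of_mem_convergentAt hf).of_norm.tsum_add
    (summable_norm_of_mem_convergentAt hg).of_norm]
  simp [add_mul]

theorem sumAt_mul {f g : MvPowerSeries σ 𝕜} (hf : f ∈ convergentAt z) (hg : g ∈ convergentAt z) :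
    sumAt (f * g) z = sumAt f z * sumAt g z := by
  classical
  have hf' := summable_norm_of_mem_convergentAt hf
  have hg' := summable_norm_of_mem_convergentAt hg
  have hfg := summable_mul_of_summable_norm hf' hg'
  have hprod := hf'.of_norm.tsum_mul_tsum_eq_tsum_sum_antidiagonal hg'.of_norm hfg
  simp_rw [sumAt, coeff_mul_mul_prod_pow]
  exact hprod.symm

/-- Evaluation at `z` of the power series that converge absolutely there. -/
def evalAt (z : σ → 𝕜) : convergentAt z →ₐ[𝕜] 𝕜 where
  toFun f := sumAt f z
  map_one' := by simpa using sumAt_C (1 : 𝕜)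
  map_mul' f g := sumAt_mul f.2 g.2
  map_zero' := by simpa using sumAt_C (0 : 𝕜)
  map_add' f g := sumAt_add f.2 g.2
  commutes' := sumAt_C

theorem evalAt_apply (f : convergentAt z) : evalAt z f = sumAt (f : MvPowerSeries σ 𝕜) z := rfl

theorem sumAt_prod_pow {a : τ → MvPowerSeries σ 𝕜} (ha : ∀ i, a i ∈ convergentAt z)
    (d : τ →₀ ℕ) :
    sumAt (d.prod fun s k => a s ^ k) z = d.prod fun s k => sumAt (a s) z ^ k := by
  have hmap := map_finsuppProd (evalAt z) d fun s k => (⟨a s, ha s⟩ : convergentAt z) ^ k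
  simpa only [map_pow, evalAt_apply, Finsupp.prod, SubmonoidClass.coe_finsetProd,
    SubmonoidClass.coe_pow] using hmap

theorem sumAt_subst {a : τ → MvPowerSeries σ 𝕜} (ha : HasSubst a)
    (haz : ∀ i, a i ∈ convergentAt z) {f : MvPowerSeries τ 𝕜}
    (hf : wnorm (fun i => wnorm (fun j => ‖z j‖ₑ) (a i)) f ≠ ⊤) :
    sumAt (subst a f) z = sumAt f fun i => sumAt (a i) z := by
  have hsum : Summable (Function.uncurry fun (d : τ →₀ ℕ) (e : σ →₀ ℕ) =>
      coeff d f * coeff e (d.prod fun s k => a s ^ k) * e.prod (z · ^ ·)) := by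
    refine Summable.of_enorm (ne_top_of_le_ne_top hf ?_)
    refine le_trans (le_of_eq ?_) (tsum_tsum_enorm_subst_le a _ f)
    rw [ENNReal.tsum_prod']
    refine tsum_congr fun d => tsum_congr fun e => ?_
    rw [Function.uncurry_apply_pair, enorm_mul, enorm_monomial_eval]
  rw [sumAt]
  simp_rw [coeff_subst_eq_tsum ha, ← tsum_mul_right]
  rw [hsum.tsum_comm, sumAt]
  refine tsum_congr fun d => ?_
  simp_rw [mul_assoc]
  rw [tsum_mul_left, ← sumAt_prod_pow haz]
  rfl

end evaluation

section value

variable {n : ℕ}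

theorem value_eq_sumAt (f : convSeries n) (z : Fin n → ℂ) :
    value f z = sumAt (f : MvPowerSeries (Fin n) ℂ) z :=
  rfl

theorem eventually_enorm_le {ι E : Type*} [Finite ι] [NormedAddCommGroup E] {w : ι → ℝ≥0∞}
    (hw : ∀ i, w i ≠ 0) : ∀ᶠ z in 𝓝 (0 : ι → E), ∀ i, ‖z i‖ₑ ≤ w i := by
  refine eventually_all.2 fun i => ?_
  have hcont : Continuous fun z : ι → E => ‖z i‖ₑ := by fun_prop
  have hlt : ‖(0 : ι → E) i‖ₑ < w i := by simpa using pos_iff_ne_zero.2 (hw i)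
  exact (hcont.continuousAt.eventually_lt continuousAt_const hlt).mono fun z hz => hz.le

theorem eventually_mem_convergentAt (f : convSeries n) :
    ∀ᶠ z in 𝓝 (0 : Fin n → ℂ), (f : MvPowerSeries (Fin n) ℂ) ∈ convergentAt z := by
  obtain ⟨w, hw, h⟩ := convergent_iff.1 f.2
  filter_upwards [eventually_enorm_le hw] with z hz
  exact ne_top_of_le_ne_top h (wnorm_mono hz _)

theorem eventually_value_add (f g : convSeries n) :
    ∀ᶠ z in 𝓝 (0 : Fin n → ℂ), value (f + g) z = value f z + value g z := by
  filter_upwards [eventually_mem_convergentAt f, eventually_mem_convergentAt g] with z hf hg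
  exact sumAt_add hf hg

theorem eventually_value_mul (f g : convSeries n) :
    ∀ᶠ z in 𝓝 (0 : Fin n → ℂ), value (f * g) z = value f z * value g z := by
  filter_upwards [eventually_mem_convergentAt f, eventually_mem_convergentAt g] with z hf hg
  exact sumAt_mul hf hg

theorem value_zero (z : Fin n → ℂ) : value (0 : convSeries n) z = 0 := by simp [value]

theorem value_one (z : Fin n → ℂ) : value (1 : convSeries n) z = 1 := by
  rw [value_eq_sumAt]
  exact sumAt_C 1

theorem value_zero_right (f : convSeries n) :
    value f 0 = constantCoeff (f : MvPowerSeries (Fin n) ℂ) :=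
  sumAt_zero_right _

end value

section identity

variable {σ 𝕜 : Type*}

theorem prod_smul_pow [CommSemiring 𝕜] (t : 𝕜) (a : σ → 𝕜) (m : σ →₀ ℕ) :
    m.prod ((t • a) · ^ ·) = t ^ m.degree * m.prod (a · ^ ·) := by
  simp [Finsupp.prod, mul_pow, Finset.prod_mul_distrib, Finset.prod_pow_eq_pow_sum,
    Finsupp.degree_apply]

open scoped Classical in
/-- The homogeneous part of degree `d` of a power series in finitely many variables, as a
polynomial. -/
def homogeneousPart [Fintype σ] [CommSemiring 𝕜] (d : ℕ) (f : MvPowerSeries σ 𝕜) :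
    MvPolynomial σ 𝕜 :=
  ∑ m ∈ Finset.finsuppAntidiag Finset.univ d, MvPolynomial.monomial m (coeff m f)

open scoped Classical in
theorem mem_finsuppAntidiag_univ [Fintype σ] {m : σ →₀ ℕ} {d : ℕ} :
    m ∈ Finset.finsuppAntidiag Finset.univ d ↔ m.degree = d := by
  simp [Finsupp.degree_eq_sum]

theorem coeff_homogeneousPart_degree [Fintype σ] [CommSemiring 𝕜] (f : MvPowerSeries σ 𝕜)
    (m : σ →₀ ℕ) :
    MvPolynomial.coeff m (homogeneousPart m.degree f) = coeff m f := by
  classical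
  rw [homogeneousPart, MvPolynomial.coeff_sum]
  simp only [MvPolynomial.coeff_monomial]
  rw [Finset.sum_ite_eq', if_pos (mem_finsuppAntidiag_univ.2 rfl)]

theorem hasSum_pow_smul_eval_homogeneousPart [Fintype σ] [NormedField 𝕜] [CompleteSpace 𝕜]
    {t : 𝕜} {a : σ → 𝕜} {f : MvPowerSeries σ 𝕜} (h : f ∈ convergentAt (t • a)) :
    HasSum (fun d => t ^ d • MvPolynomial.eval a (homogeneousPart d f)) (sumAt f (t • a)) := by
  classical
  convert! (summable_norm_of_mem_convergentAt h).of_norm.hasSum.tsum_fiberwise Finsupp.degree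
    using 2 with d
  have hfiber : (Finsupp.degree ⁻¹' {d} : Set (σ →₀ ℕ)) =
      ↑(Finset.finsuppAntidiag (Finset.univ : Finset σ) d) :=
    Set.ext fun m => mem_finsuppAntidiag_univ.symm
  rw [hfiber, Finset.tsum_subtype' (Finset.finsuppAntidiag Finset.univ d)
    fun m => coeff m f * m.prod ((t • a) · ^ ·), homogeneousPart, map_sum, Finset.smul_sum]
  refine Finset.sum_congr rfl fun m hm => ?_
  rw [MvPolynomial.eval_monomial, prod_smul_pow, mem_finsuppAntidiag_univ.1 hm, smul_eq_mul,
    mul_left_comm]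

theorem eq_zero_of_eventually_sumAt_eq_zero [Finite σ] [NontriviallyNormedField 𝕜] [CompleteSpace 𝕜]
    {f : MvPowerSeries σ 𝕜} (hf : ∀ᶠ z in 𝓝 0, f ∈ convergentAt z)
    (h : ∀ᶠ z in 𝓝 0, sumAt f z = 0) : f = 0 := by
  have := Fintype.ofFinite σ
  have hpart (d : ℕ) : homogeneousPart d f = 0 := by
    refine MvPolynomial.funext fun a => ?_
    have hline : Tendsto (fun t : 𝕜 => t • a) (𝓝 0) (𝓝 0) := by
      have hcont : Continuous fun t : 𝕜 => t • a := by fun_prop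
      simpa using hcont.tendsto 0
    have hseries : HasFPowerSeriesAt (0 : 𝕜 → 𝕜) (FormalMultilinearSeries.ofScalars 𝕜
        fun d => MvPolynomial.eval a (homogeneousPart d f)) 0 := by
      rw [hasFPowerSeriesAt_iff]
      filter_upwards [hline.eventually h, hline.eventually hf] with t ht htf
      simpa [ht] using hasSum_pow_smul_eval_homogeneousPart htf
    have hcoeff := congrArg (FormalMultilinearSeries.coeff · d) hseries.eq_zero
    rwa [FormalMultilinearSeries.coeff_ofScalars] at hcoeff
  ext m
  rw [← coeff_homogeneousPart_degree, hpart, MvPolynomial.coeff_zero, map_zero]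

theorem eq_zero_of_eventually_value_eq_zero {n : ℕ} {f : convSeries n}
    (h : ∀ᶠ z in 𝓝 (0 : Fin n → ℂ), value f z = 0) : f = 0 :=
  Subtype.ext (eq_zero_of_eventually_sumAt_eq_zero (eventually_mem_convergentAt f) h)

end identity

/-! ### Weierstrass division -/

section contraction

open scoped MvPowerSeries.WithPiTopology

variable {σ 𝕜 : Type*} [NormedField 𝕜] {w : σ → ℝ≥0∞}

theorem wnorm_tsum_le {ι : Type*} (w : σ → ℝ≥0∞) {T : ι → MvPowerSeries σ 𝕜} (hT : Summable T) :
    wnorm w (∑' k, T k) ≤ ∑' k, wnorm w (T k) := by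
  simp_rw [wnorm]
  rw [ENNReal.tsum_comm]
  refine ENNReal.tsum_le_tsum fun m => ?_
  rw [ENNReal.tsum_mul_right,
    ← (WithPiTopology.hasSum_iff_hasSum_coeff.1 hT.hasSum m).tsum_eq]
  gcongr
  exact enorm_tsum_le_tsum_enorm

variable [CompleteSpace 𝕜]

theorem summable_of_tsum_wnorm_ne_top {ι : Type*} (hw : ∀ i, w i ≠ 0)
    {T : ι → MvPowerSeries σ 𝕜} (hT : ∑' k, wnorm w (T k) ≠ ⊤) : Summable T := by
  refine WithPiTopology.summable_iff_summable_coeff.2 fun m => ?_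
  refine Summable.of_enorm fun htop => hT (top_le_iff.1 ?_)
  calc (⊤ : ℝ≥0∞) = (∑' k, ‖coeff m (T k)‖ₑ) * monomialWeight w m := by
        rw [htop, ENNReal.top_mul (monomialWeight_ne_zero hw m)]
    _ = ∑' k, ‖coeff m (T k)‖ₑ * monomialWeight w m := ENNReal.tsum_mul_right.symm
    _ ≤ ∑' k, wnorm w (T k) :=
      ENNReal.tsum_le_tsum fun k => enorm_coeff_mul_monomialWeight_le_wnorm w (T k) m

theorem exists_eq_add_apply_of_two_mul_wnorm_le (hw : ∀ i, w i ≠ 0)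
    {L : MvPowerSeries σ 𝕜 →ₗ[𝕜] MvPowerSeries σ 𝕜} (hLc : Continuous L)
    (hL : ∀ Q, 2 * wnorm w (L Q) ≤ wnorm w Q) {F : MvPowerSeries σ 𝕜} (hF : wnorm w F ≠ ⊤) :
    ∃ Q, wnorm w Q ≠ ⊤ ∧ Q = F + L Q := by
  have hiter (k : ℕ) : wnorm w (L^[k] F) ≤ 2⁻¹ ^ k * wnorm w F := by
    induction k with
    | zero => simp
    | succ k ih =>
      rw [Function.iterate_succ_apply', pow_succ', mul_assoc]
      exact (ENNReal.mul_le_iff_le_inv (by simp) (by simp)).1 ((hL _).trans ih)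
  have htsum : ∑' k, wnorm w (L^[k] F) ≠ ⊤ := by
    refine ne_top_of_le_ne_top ?_ (ENNReal.tsum_le_tsum hiter)
    rw [ENNReal.tsum_mul_right, ENNReal.tsum_geometric]
    exact ENNReal.mul_ne_top (by simp) hF
  have hsum := summable_of_tsum_wnorm_ne_top hw htsum
  refine ⟨∑' k, L^[k] F, ne_top_of_le_ne_top htsum (wnorm_tsum_le w hsum), ?_⟩
  have hLsum := (hsum.hasSum.map L hLc).tsum_eq
  rw [← hLsum, hsum.tsum_eq_zero_add]
  simp only [Function.iterate_succ_apply', Function.iterate_zero_apply, Function.comp_apply]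

end contraction

section divMonomial

variable {σ R : Type*}

/-- The power series with coefficients `f_{m + s}`: the quotient of the division of `f` by the
monomial `x ^ s`. -/
def divMonomial [Semiring R] (s : σ →₀ ℕ) : MvPowerSeries σ R →ₗ[R] MvPowerSeries σ R where
  toFun f m := coeff (m + s) f
  map_add' _ _ := rfl
  map_smul' _ _ := rfl

theorem coeff_divMonomial [Semiring R] (s m : σ →₀ ℕ) (f : MvPowerSeries σ R) :
    coeff m (divMonomial s f) = coeff (m + s) f :=
  rfl

open scoped MvPowerSeries.WithPiTopology in
theorem continuous_divMonomial [Semiring R] [TopologicalSpace R] (s : σ →₀ ℕ) :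
    Continuous (divMonomial s : MvPowerSeries σ R →ₗ[R] MvPowerSeries σ R) :=
  continuous_pi fun m => WithPiTopology.continuous_coeff R (m + s)

theorem divMonomial_X_pow_mul [CommSemiring R] (i : σ) (d : ℕ) (f : MvPowerSeries σ R) :
    divMonomial (Finsupp.single i d) (X i ^ d * f) = f := by
  ext m
  rw [coeff_divMonomial, X_pow_eq, add_comm m, coeff_add_monomial_mul, one_mul]

theorem divMonomial_single_eq_zero_iff [Semiring R] {i : σ} {d : ℕ} {r : MvPowerSeries σ R} :
    divMonomial (Finsupp.single i d) r = 0 ↔ ∀ m, d ≤ m i → coeff m r = 0 := by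
  refine ⟨fun h m hm => ?_, fun h => MvPowerSeries.ext fun m => h _ (by simp)⟩
  rw [← tsub_add_cancel_of_le (Finsupp.single_le_iff.2 hm), ← coeff_divMonomial, h, map_zero]

variable {𝕜 : Type*} [NormedField 𝕜] {w : σ → ℝ≥0∞} {s : σ →₀ ℕ}

theorem monomialWeight_mul_wnorm_divMonomial_le (w : σ → ℝ≥0∞) (s : σ →₀ ℕ)
    (f : MvPowerSeries σ 𝕜) : monomialWeight w s * wnorm w (divMonomial s f) ≤ wnorm w f := by
  have hterm (m : σ →₀ ℕ) : monomialWeight w s * (‖coeff m (divMonomial s f)‖ₑ *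
      monomialWeight w m) = ‖coeff (m + s) f‖ₑ * monomialWeight w (m + s) := by
    rw [coeff_divMonomial, monomialWeight_add]
    ring
  rw [wnorm, ← ENNReal.tsum_mul_left]
  simp_rw [hterm]
  exact ENNReal.tsum_comp_le_tsum_of_injective (add_left_injective s)
    fun m => ‖coeff m f‖ₑ * monomialWeight w m

theorem Convergent.divMonomial {n : ℕ} {f : MvPowerSeries (Fin n) ℂ} (hf : Convergent f)
    (s : Fin n →₀ ℕ) : Convergent (divMonomial s f) := by
  obtain ⟨w, hw, h⟩ := convergent_iff.1 hf
  refine convergent_iff.2 ⟨w, hw, fun htop => h (top_le_iff.1 ?_)⟩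
  simpa [htop, monomialWeight_ne_zero hw s] using monomialWeight_mul_wnorm_divMonomial_le w s f

theorem two_mul_wnorm_divMonomial_mul_le (hw0 : ∀ i, w i ≠ 0) (hwt : ∀ i, w i ≠ ⊤)
    {W : MvPowerSeries σ 𝕜} (hW : 2 * wnorm w W ≤ monomialWeight w s) (Q : MvPowerSeries σ 𝕜) :
    2 * wnorm w (divMonomial s (Q * W)) ≤ wnorm w Q := by
  rw [← ENNReal.mul_le_mul_iff_right (monomialWeight_ne_zero hw0 s) (monomialWeight_ne_top hwt s)]
  calc monomialWeight w s * (2 * wnorm w (divMonomial s (Q * W)))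
      = 2 * (monomialWeight w s * wnorm w (divMonomial s (Q * W))) := by ring
    _ ≤ 2 * (wnorm w Q * wnorm w W) :=
        mul_le_mul_right ((monomialWeight_mul_wnorm_divMonomial_le _ _ _).trans
          (wnorm_mul_le _ _ _)) _
    _ = wnorm w Q * (2 * wnorm w W) := by ring
    _ ≤ wnorm w Q * monomialWeight w s := by gcongr
    _ = monomialWeight w s * wnorm w Q := mul_comm _ _

open scoped MvPowerSeries.WithPiTopology in
theorem exists_eq_add_divMonomial_mul [CompleteSpace 𝕜] (hw0 : ∀ i, w i ≠ 0) (hwt : ∀ i, w i ≠ ⊤)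
    {W : MvPowerSeries σ 𝕜} (hW : 2 * wnorm w W ≤ monomialWeight w s) {F : MvPowerSeries σ 𝕜}
    (hF : wnorm w F ≠ ⊤) : ∃ Q, wnorm w Q ≠ ⊤ ∧ Q = F + divMonomial s (Q * W) :=
  exists_eq_add_apply_of_two_mul_wnorm_le (L := divMonomial s ∘ₗ LinearMap.mulRight 𝕜 W) hw0
    ((continuous_divMonomial s).comp (continuous_id.mul continuous_const))
    (two_mul_wnorm_divMonomial_mul_le hw0 hwt hW) hF

end divMonomial

section units

variable {n : ℕ} {f g : MvPowerSeries (Fin n) ℂ}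

theorem Convergent.sub (hf : Convergent f) (hg : Convergent g) : Convergent (f - g) :=
  (convSeries n).sub_mem hf hg

theorem convergent_X (i : Fin n) : Convergent (X i : MvPowerSeries (Fin n) ℂ) :=
  convergent_iff.2 ⟨fun _ => 1, by simp, by simp [wnorm_X]⟩

theorem Convergent.exists_mul_eq_one (hf : Convergent f) (h0 : constantCoeff f ≠ 0) :
    ∃ g, Convergent g ∧ f * g = 1 := by
  set c := constantCoeff f with hc
  have hcc : Convergent (C c⁻¹ : MvPowerSeries (Fin n) ℂ) := Convergent.const c⁻¹
  have hW : Convergent (1 - C c⁻¹ * f) := Convergent.sub (convSeries n).one_mem (hcc.mul hf)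
  obtain ⟨w, hw, hwW⟩ := hW.exists_wnorm_le (by simp [← hc, h0]) (ε := 2⁻¹) (by simp)
  have hcontr (Q : MvPowerSeries (Fin n) ℂ) : 2 * wnorm w (Q * (1 - C c⁻¹ * f)) ≤ wnorm w Q := by
    calc 2 * wnorm w (Q * (1 - C c⁻¹ * f)) ≤ 2 * (wnorm w Q * 2⁻¹) := by
          gcongr
          exact (wnorm_mul_le _ _ _).trans (by gcongr)
      _ = wnorm w Q := by
          rw [mul_comm, mul_assoc, ENNReal.inv_mul_cancel (by simp) (by simp), mul_one]
  open scoped MvPowerSeries.WithPiTopology in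
  obtain ⟨Q, hQ, hQe⟩ := exists_eq_add_apply_of_two_mul_wnorm_le
    (L := LinearMap.mulRight ℂ (1 - C c⁻¹ * f)) (F := 1) hw
    (continuous_id.mul continuous_const) hcontr (by simp [wnorm_one])
  rw [LinearMap.mulRight_apply] at hQe
  exact ⟨C c⁻¹ * Q, hcc.mul (convergent_iff.2 ⟨w, hw, hQ⟩), by linear_combination hQe⟩

theorem isUnit_iff (f : convSeries n) :
    IsUnit f ↔ constantCoeff (f : MvPowerSeries (Fin n) ℂ) ≠ 0 := by
  refine ⟨fun h => ((h.map (convSeries n).val).map constantCoeff).ne_zero, fun h => ?_⟩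
  obtain ⟨g, hg, hfg⟩ := f.2.exists_mul_eq_one h
  exact IsUnit.of_mul_eq_one (⟨g, hg⟩ : convSeries n) (Subtype.ext hfg)

end units

section division

variable {n : ℕ} {i : Fin n} {h : MvPowerSeries (Fin n) ℂ} {d : ℕ}

/-- `h` is regular of order `d` in the variable `xᵢ`: its restriction to the `xᵢ`-axis vanishes to
order exactly `d`. -/
def IsRegular (i : Fin n) (h : MvPowerSeries (Fin n) ℂ) (d : ℕ) : Prop :=
  (∀ k < d, coeff (Finsupp.single i k) h = 0) ∧ coeff (Finsupp.single i d) h ≠ 0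

theorem coeff_single_mul {σ R : Type*} [Semiring R] (i : σ) (f g : MvPowerSeries σ R) (k : ℕ) :
    coeff (Finsupp.single i k) (f * g) = ∑ p ∈ Finset.HasAntidiagonal.antidiagonal k,
      coeff (Finsupp.single i p.1) f * coeff (Finsupp.single i p.2) g := by
  classical
  rw [coeff_mul, Finsupp.antidiagonal_single, Finset.sum_map]
  rfl

theorem coeff_single_mul_eq_zero {σ R : Type*} [Semiring R] {i : σ} {f : MvPowerSeries σ R}
    (hf : ∀ k, coeff (Finsupp.single i k) f = 0) (g : MvPowerSeries σ R) (k : ℕ) :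
    coeff (Finsupp.single i k) (f * g) = 0 := by
  rw [coeff_single_mul]
  exact Finset.sum_eq_zero fun p _ => by rw [hf, zero_mul]

theorem wnorm_ite_mul_le {σ 𝕜 : Type*} [DecidableEq σ] [NormedField 𝕜] {i : σ}
    {f : MvPowerSeries σ 𝕜} {t : ℝ≥0∞} (ht : t ≤ 1) (w : σ → ℝ≥0∞)
    (hf : ∀ k, coeff (Finsupp.single i k) f = 0) :
    wnorm (fun j => if j = i then w j else t * w j) f ≤ t * wnorm w f := by
  refine wnorm_le_mul_wnorm (fun j => ?_) fun m hm => ?_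
  · split_ifs
    exacts [le_rfl, mul_le_of_le_one_left' ht]
  · by_contra! hlt
    obtain ⟨k, rfl⟩ : ∃ k, m = Finsupp.single i k := by
      refine Finsupp.support_subset_singleton'.1 fun j hj => Finset.mem_singleton.2 ?_
      by_contra hji
      simpa [hji] using hlt j (Finsupp.mem_support_iff.1 hj)
    exact hm (hf k)

theorem Convergent.exists_common_weight {f g : MvPowerSeries (Fin n) ℂ} (hf : Convergent f)
    (hg : Convergent g) : ∃ w : Fin n → ℝ≥0∞, (∀ j, w j ≠ 0) ∧ (∀ j, w j ≠ ⊤) ∧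
      wnorm w f ≠ ⊤ ∧ wnorm w g ≠ ⊤ := by
  obtain ⟨w₁, hw₁, hf₁⟩ := convergent_iff.1 hf
  obtain ⟨w₂, hw₂, hg₂⟩ := convergent_iff.1 hg
  refine ⟨fun j => min 1 (min (w₁ j) (w₂ j)), fun j => by simp [hw₁, hw₂], fun j => by simp,
    ne_top_of_le_ne_top hf₁ (wnorm_mono (fun j => ?_) f),
    ne_top_of_le_ne_top hg₂ (wnorm_mono (fun j => ?_) g)⟩
  exacts [(min_le_right _ _).trans (min_le_left _ _), (min_le_right _ _).trans (min_le_right _ _)]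

/-- Shrinking all the radii but the `i`-th makes a series vanishing on the `xᵢ`-axis small compared
with `xᵢ ^ d`. -/
theorem exists_two_mul_wnorm_le_pow {W F : MvPowerSeries (Fin n) ℂ} (hW : Convergent W)
    (hF : Convergent F) (hW0 : ∀ k, coeff (Finsupp.single i k) W = 0) (d : ℕ) :
    ∃ w : Fin n → ℝ≥0∞, (∀ j, w j ≠ 0) ∧ (∀ j, w j ≠ ⊤) ∧ wnorm w F ≠ ⊤ ∧
      2 * wnorm w W ≤ w i ^ d := by
  obtain ⟨w, hw0, hwt, hwW, hwF⟩ := hW.exists_common_weight hF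
  obtain ⟨t, ht0, ht⟩ := ENNReal.exists_nnreal_pos_mul_lt
    (ENNReal.mul_ne_top (ENNReal.ofNat_ne_top (n := 2)) hwW) (pow_ne_zero d (hw0 i))
  set τ : ℝ≥0∞ := min t 1
  have hτ0 : τ ≠ 0 := by simpa [τ] using ht0.ne'
  have hτ1 : τ ≤ 1 := min_le_right _ _
  have hle (j) : (if j = i then w j else τ * w j) ≤ w j := by
    split_ifs
    exacts [le_rfl, mul_le_of_le_one_left' hτ1]
  refine ⟨fun j => if j = i then w j else τ * w j, fun j => ?_,
    fun j => ne_top_of_le_ne_top (hwt j) (hle j),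
    ne_top_of_le_ne_top hwF (wnorm_mono hle F), ?_⟩
  · beta_reduce
    split_ifs
    exacts [hw0 j, mul_ne_zero hτ0 (hw0 j)]
  · beta_reduce
    rw [if_pos rfl]
    calc 2 * wnorm (fun j => if j = i then w j else τ * w j) W
        ≤ 2 * (τ * wnorm w W) := by gcongr; exact wnorm_ite_mul_le hτ1 w hW0
      _ = τ * (2 * wnorm w W) := by ring
      _ ≤ t * (2 * wnorm w W) := by gcongr; exact min_le_left _ _
      _ ≤ w i ^ d := ht.le

/-- Up to the unit `v`, a series regular of order `d` is `xᵢ ^ d` minus a series vanishing on the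
`xᵢ`-axis, hence a small perturbation of `xᵢ ^ d` for suitable radii. -/
theorem IsRegular.exists_unit_mul_eq_X_pow_sub (hr : IsRegular i h d) (hh : Convergent h) :
    ∃ u v W : MvPowerSeries (Fin n) ℂ, Convergent u ∧ Convergent v ∧ Convergent W ∧
      u * v = 1 ∧ h * v = X i ^ d - W ∧ ∀ k, coeff (Finsupp.single i k) W = 0 := by
  set u := divMonomial (Finsupp.single i d) h with hu_def
  have hu : Convergent u := hh.divMonomial (Finsupp.single i d)
  have hu0 : constantCoeff u ≠ 0 := by
    rw [← coeff_zero_eq_constantCoeff_apply, coeff_divMonomial, zero_add]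
    exact hr.2
  obtain ⟨v, hv, huv⟩ := hu.exists_mul_eq_one hu0
  have haxis (k : ℕ) : coeff (Finsupp.single i k) (X i ^ d * u - h) = 0 := by
    rw [map_sub, X_pow_eq, coeff_monomial_mul]
    split_ifs with hk
    · rw [hu_def, coeff_divMonomial, one_mul, tsub_add_cancel_of_le hk, sub_self]
    · rw [hr.1 k (by simpa using hk), sub_zero]
  have hX : Convergent ((X i : MvPowerSeries (Fin n) ℂ) ^ d) :=
    (convSeries n).pow_mem (convergent_X i) d
  refine ⟨u, v, (X i ^ d * u - h) * v, hu, hv, ((hX.mul hu).sub hh).mul hv, huv, ?_,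
    coeff_single_mul_eq_zero haxis v⟩
  linear_combination X i ^ d * huv

theorem IsRegular.exists_eq_mul_add (hr : IsRegular i h d) (hh : Convergent h)
    {F : MvPowerSeries (Fin n) ℂ} (hF : Convergent F) :
    ∃ q r, Convergent q ∧ Convergent r ∧ F = q * h + r ∧ ∀ m, d ≤ m i → coeff m r = 0 := by
  obtain ⟨_, v, W, _, hv, hW, _, hhv, hW0⟩ := hr.exists_unit_mul_eq_X_pow_sub hh
  obtain ⟨w, hw0, hwt, hwF, hwW⟩ :=
    exists_two_mul_wnorm_le_pow hW (hF.divMonomial (Finsupp.single i d)) hW0 d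
  rw [← monomialWeight_single] at hwW
  obtain ⟨Q, hQ, hQe⟩ := exists_eq_add_divMonomial_mul hw0 hwt hwW hwF
  have hvQ : Convergent (v * Q) := hv.mul (convergent_iff.2 ⟨w, hw0, hQ⟩)
  refine ⟨v * Q, F - v * Q * h, hvQ, hF.sub (hvQ.mul hh), by ring,
    divMonomial_single_eq_zero_iff.1 ?_⟩
  have hvQh : v * Q * h = X i ^ d * Q - Q * W := by linear_combination Q * hhv
  rw [hvQh, map_sub, map_sub, divMonomial_X_pow_mul]
  linear_combination -hQe

theorem IsRegular.eq_zero_of_mul_eq (hr : IsRegular i h d) (hh : Convergent h)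
    {q r : MvPowerSeries (Fin n) ℂ} (hq : Convergent q) (hqr : q * h = r)
    (hrd : ∀ m, d ≤ m i → coeff m r = 0) : q = 0 := by
  obtain ⟨u, v, W, hu, _, hW, huv, hhv, hW0⟩ := hr.exists_unit_mul_eq_X_pow_sub hh
  obtain ⟨w, hw0, hwt, hwQ, hwW⟩ := exists_two_mul_wnorm_le_pow hW (hq.mul hu) hW0 d
  rw [← monomialWeight_single] at hwW
  have hfix : q * u = divMonomial (Finsupp.single i d) (q * u * W) := by
    have hr0 := divMonomial_single_eq_zero_iff.2 hrd
    have hr_eq : r = X i ^ d * (q * u) - q * u * W := by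
      linear_combination -hqr - q * h * huv + q * u * hhv
    rw [hr_eq, map_sub, divMonomial_X_pow_mul] at hr0
    exact sub_eq_zero.1 hr0
  have hle := two_mul_wnorm_divMonomial_mul_le hw0 hwt hwW (q * u)
  rw [← hfix] at hle
  have hnorm : wnorm w (q * u) = 0 := by
    by_contra h0
    exact (ENNReal.lt_add_right hwQ h0).not_ge (two_mul (wnorm w (q * u)) ▸ hle)
  linear_combination v * eq_zero_of_wnorm_eq_zero hw0 hnorm - q * huv

theorem IsRegular.coeff_single_mul (hr : IsRegular i h d) (q : MvPowerSeries (Fin n) ℂ) {k : ℕ}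
    (hk : k ≤ d) :
    coeff (Finsupp.single i k) (q * h) = constantCoeff q * coeff (Finsupp.single i k) h := by
  rw [ConvSeries.coeff_single_mul, Finset.sum_eq_single (0, k), Finsupp.single_zero,
    coeff_zero_eq_constantCoeff_apply]
  · intro p hp hne
    have hsum := Finset.HasAntidiagonal.mem_antidiagonal.1 hp
    have hp0 : p.1 ≠ 0 := fun h0 => hne (Prod.ext h0 (by simpa [h0] using hsum))
    rw [hr.1 p.2 (by omega), mul_zero]
  · simp

end division

/-! ### Power series with coefficients in a power series ring -/

section substitution

variable {n p : ℕ}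

/-- Substitution of convergent power series without constant term. -/
def substConv (a : Fin p → convSeries n)
    (ha : ∀ i, constantCoeff (a i : MvPowerSeries (Fin n) ℂ) = 0) :
    convSeries p →ₐ[ℂ] convSeries n :=
  ((substAlgHom (R := ℂ) (hasSubst_of_constantCoeff_zero ha)).comp
    (convSeries p).val).codRestrict (convSeries n) fun f => by
      rw [AlgHom.comp_apply, substAlgHom_apply]
      exact Convergent.subst (fun i => (a i).2) ha f.2

variable {a : Fin p → convSeries n} {ha : ∀ i, constantCoeff (a i : MvPowerSeries (Fin n) ℂ) = 0}

theorem coe_substConv (f : convSeries p) :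
    (substConv a ha f : MvPowerSeries (Fin n) ℂ) =
      subst (fun i => (a i : MvPowerSeries (Fin n) ℂ)) (f : MvPowerSeries (Fin p) ℂ) := by
  simp only [substConv, AlgHom.coe_codRestrict, AlgHom.comp_apply, Subalgebra.val_apply,
    substAlgHom_apply]

theorem value_substConv {z : Fin n → ℂ}
    (haz : ∀ i, (a i : MvPowerSeries (Fin n) ℂ) ∈ convergentAt z) {f : convSeries p}
    (hf : wnorm (fun i => wnorm (fun j => ‖z j‖ₑ) (a i : MvPowerSeries (Fin n) ℂ))
      (f : MvPowerSeries (Fin p) ℂ) ≠ ⊤) :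
    value (substConv a ha f) z = value f fun i => value (a i) z := by
  rw [value_eq_sumAt, coe_substConv, sumAt_subst (hasSubst_of_constantCoeff_zero ha) haz hf]
  rfl

theorem eventually_value_substConv (f : convSeries p) :
    ∀ᶠ z in 𝓝 (0 : Fin n → ℂ), value (substConv a ha f) z = value f fun i => value (a i) z := by
  obtain ⟨v, hv, hfv⟩ := convergent_iff.1 f.2
  choose w hw hwa using fun i => (a i).2.exists_wnorm_le (ha i) (hv i)
  have hsmall : ∀ᶠ z in 𝓝 (0 : Fin n → ℂ), ∀ i j, ‖z j‖ₑ ≤ w i j :=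
    eventually_all.2 fun i => eventually_enorm_le (hw i)
  filter_upwards [hsmall, eventually_all.2 fun i => eventually_mem_convergentAt (a i)]
    with z hzw hza
  exact value_substConv hza <| ne_top_of_le_ne_top hfv <|
    wnorm_mono (fun i => (wnorm_mono (hzw i) _).trans (hwa i)) _

/-- The coordinate `xᵢ`. -/
def coord (i : Fin n) : convSeries n := ⟨X i, convergent_X i⟩

@[simp] theorem coe_coord (i : Fin n) : (coord i : MvPowerSeries (Fin n) ℂ) = X i := rfl

theorem value_coord (i : Fin n) (z : Fin n → ℂ) : value (coord i) z = z i := sumAt_X i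

theorem eventually_value_sum {ι : Type*} (s : Finset ι) (f : ι → convSeries n) :
    ∀ᶠ z in 𝓝 (0 : Fin n → ℂ), value (∑ i ∈ s, f i) z = ∑ i ∈ s, value (f i) z := by
  classical
  induction s using Finset.induction_on with
  | empty => simp [value_zero]
  | insert b s hb ih =>
    rw [Finset.sum_insert hb]
    filter_upwards [ih, eventually_value_add (f b) (∑ i ∈ s, f i)] with z hs hadd
    rw [hadd, hs, Finset.sum_insert hb]

theorem eventually_value_pow (f : convSeries n) (k : ℕ) :
    ∀ᶠ z in 𝓝 (0 : Fin n → ℂ), value (f ^ k) z = value f z ^ k := by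
  filter_upwards [eventually_mem_convergentAt f] with z hz
  exact map_pow (evalAt z) (⟨f, hz⟩ : convergentAt z) k

end substitution

section polynomials

variable {n : ℕ}

theorem ext_cons {R : Type*} [Semiring R] {f g : MvPowerSeries (Fin (n + 1)) R}
    (h : ∀ k x, coeff (Finsupp.cons k x) f = coeff (Finsupp.cons k x) g) : f = g := by
  ext m
  rw [← Finsupp.cons_tail m]
  exact h _ _

theorem cons_add_single_zero {M : Type*} [AddZeroClass M] (k j : M) (x : Fin n →₀ M) :
    Finsupp.cons k x + Finsupp.single 0 j = Finsupp.cons (k + j) x := by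
  ext i
  refine Fin.cases ?_ (fun i => ?_) i <;> simp

theorem cons_add_single_succ {M : Type*} [AddZeroClass M] (k j : M) (x : Fin n →₀ M) (i : Fin n) :
    Finsupp.cons k x + Finsupp.single i.succ j = Finsupp.cons k (x + Finsupp.single i j) := by
  ext l
  refine Fin.cases ?_ (fun l => ?_) l <;> simp [Finsupp.single_apply]

theorem cons_zero_eq_embDomain {M : Type*} [Zero M] (x : Fin n →₀ M) :
    Finsupp.cons 0 x = x.embDomain (Fin.succEmb n) := by
  ext i
  refine Fin.cases ?_ (fun i => ?_) i
  · rw [Finsupp.cons_zero, Finsupp.embDomain_of_notMem_range]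
    rintro ⟨j, hj⟩
    exact Fin.succ_ne_zero j hj
  · exact (Finsupp.cons_succ i 0 x).trans (Finsupp.embDomain_apply_self (Fin.succEmb n) x i).symm

/-- The inclusion of the convergent power series in `x₁, …, xₙ` in those in `x₀, …, xₙ`. -/
def lift : convSeries n →ₐ[ℂ] convSeries (n + 1) :=
  substConv (fun i => coord i.succ) fun i => by rw [coe_coord, constantCoeff_X]

theorem coe_lift (a : convSeries n) : (lift a : MvPowerSeries (Fin (n + 1)) ℂ) =
    rename (Fin.succEmb n) (a : MvPowerSeries (Fin n) ℂ) := by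
  rw [rename_eq_subst, lift, coe_substConv]
  rfl

theorem coeff_lift (a : convSeries n) (k : ℕ) (x : Fin n →₀ ℕ) :
    coeff (Finsupp.cons k x) (lift a : MvPowerSeries (Fin (n + 1)) ℂ) =
      if k = 0 then coeff x (a : MvPowerSeries (Fin n) ℂ) else 0 := by
  rw [coe_lift]
  split_ifs with hk
  · rw [hk, cons_zero_eq_embDomain, coeff_embDomain_rename]
  · refine coeff_rename_eq_zero _ _ ?_
    rintro ⟨y, hy⟩
    have hk0 := DFunLike.congr_fun hy 0
    rw [← Finsupp.embDomain_eq_mapDomain, ← cons_zero_eq_embDomain, Finsupp.cons_zero,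
      Finsupp.cons_zero] at hk0
    exact hk hk0.symm

theorem eventually_value_lift (a : convSeries n) :
    ∀ᶠ z in 𝓝 (0 : Fin (n + 1) → ℂ), value (lift a) z = value a (Fin.tail z) := by
  filter_upwards [eventually_value_substConv (a := fun i : Fin n => coord i.succ)
    (ha := fun i => by rw [coe_coord, constantCoeff_X]) a] with z hz
  simp only [value_coord] at hz
  exact hz

theorem coe_pd (i : Fin n) (f : convSeries n) : (pd i f : MvPowerSeries (Fin n) ℂ) =
    MvPowerSeries.pderiv ℂ i (f : MvPowerSeries (Fin n) ℂ) :=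
  rfl

theorem pd_zero_lift (a : convSeries n) : pd 0 (lift a) = 0 := by
  refine Subtype.ext (ext_cons fun k x => ?_)
  rw [coe_pd, coeff_pderiv, cons_add_single_zero, coeff_lift, if_neg k.succ_ne_zero, zero_mul]
  simp

theorem pd_succ_lift (i : Fin n) (a : convSeries n) : pd i.succ (lift a) = lift (pd i a) := by
  refine Subtype.ext (ext_cons fun k x => ?_)
  rw [coe_pd, coeff_pderiv, cons_add_single_succ, coeff_lift, coeff_lift, Finsupp.cons_succ,
    coe_pd, coeff_pderiv, ite_mul, zero_mul]

/-- The inclusion of the polynomials in `x₀` with coefficients convergent power series in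
`x₁, …, xₙ`. -/
def polyMap : Polynomial (convSeries n) →+* convSeries (n + 1) :=
  Polynomial.eval₂RingHom (lift : convSeries n →ₐ[ℂ] convSeries (n + 1)).toRingHom (coord 0)

theorem polyMap_C (a : convSeries n) : polyMap (Polynomial.C a) = lift a := by
  simp [polyMap]

theorem polyMap_X : polyMap (Polynomial.X : Polynomial (convSeries n)) = coord 0 := by
  simp [polyMap]

theorem polyMap_monomial (k : ℕ) (a : convSeries n) :
    polyMap (Polynomial.monomial k a) = lift a * coord 0 ^ k := by
  simp [polyMap]

theorem coeff_polyMap (R : Polynomial (convSeries n)) (k : ℕ) (x : Fin n →₀ ℕ) :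
    coeff (Finsupp.cons k x) (polyMap R : MvPowerSeries (Fin (n + 1)) ℂ) =
      coeff x (R.coeff k : MvPowerSeries (Fin n) ℂ) := by
  induction R using Polynomial.induction_on' with
  | add p q hp hq =>
    rw [map_add, Polynomial.coeff_add, AddMemClass.coe_add, AddMemClass.coe_add, map_add, map_add,
      hp, hq]
  | monomial j a =>
    rw [polyMap_monomial, MulMemClass.coe_mul, SubmonoidClass.coe_pow, coe_coord, X_pow_eq,
      Polynomial.coeff_monomial]
    obtain ⟨l, rfl⟩ | hkj := (le_or_gt j k).imp_left Nat.exists_eq_add_of_le'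
    · rw [← cons_add_single_zero, coeff_add_mul_monomial, coeff_lift, mul_one]
      by_cases hl : l = 0 <;> simp [hl]
    · rw [coeff_mul_monomial, if_neg, if_neg hkj.ne']
      · rfl
      · exact fun hle => hkj.not_ge (by simpa using hle 0)

theorem polyMap_injective : Function.Injective (polyMap (n := n)) := by
  intro P Q hPQ
  refine Polynomial.ext fun k => Subtype.ext (MvPowerSeries.ext fun x => ?_)
  rw [← coeff_polyMap, hPQ, coeff_polyMap]

theorem pd_zero_polyMap (P : Polynomial (convSeries n)) :
    pd 0 (polyMap P) = polyMap (Polynomial.derivative P) := by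
  induction P using Polynomial.induction_on' with
  | add p q hp hq => simp only [map_add, hp, hq]
  | monomial j a =>
    have hX : pd 0 (coord 0 : convSeries (n + 1)) = 1 :=
      Subtype.ext (MvPowerSeries.pderiv_X_self)
    rw [polyMap_monomial, Polynomial.derivative_monomial, polyMap_monomial, Derivation.leibniz,
      Derivation.leibniz_pow, pd_zero_lift, hX, map_mul, map_natCast]
    simp only [smul_eq_mul, nsmul_eq_mul]
    ring

theorem eventually_value_polyMap (R : Polynomial (convSeries n)) :
    ∀ᶠ z in 𝓝 (0 : Fin (n + 1) → ℂ), value (polyMap R) z =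
      ∑ k ∈ Finset.range (R.natDegree + 1), value (R.coeff k) (Fin.tail z) * z 0 ^ k := by
  have hsum : polyMap R =
      ∑ k ∈ Finset.range (R.natDegree + 1), lift (R.coeff k) * coord 0 ^ k := by
    conv_lhs => rw [R.as_sum_range]
    simp [polyMap_monomial]
  have hterm : ∀ᶠ z in 𝓝 (0 : Fin (n + 1) → ℂ), ∀ k ∈ Finset.range (R.natDegree + 1),
      value (lift (R.coeff k) * coord 0 ^ k) z = value (R.coeff k) (Fin.tail z) * z 0 ^ k := by
    rw [Finset.eventually_all]
    intro k _
    filter_upwards [eventually_value_lift (R.coeff k), eventually_value_mul (lift (R.coeff k))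
      (coord 0 ^ k), eventually_value_pow (coord (0 : Fin (n + 1))) k] with z hlift hmul hpow
    rw [hmul, hlift, hpow, value_coord]
  filter_upwards [eventually_value_sum (Finset.range (R.natDegree + 1))
    fun k => lift (R.coeff k) * coord 0 ^ k, hterm] with z hvalue hz
  rw [hsum, hvalue]
  exact Finset.sum_congr rfl hz

/-- The coefficient of `x₀ ^ k`, a power series in `x₁, …, xₙ`. -/
def slice {R : Type*} (k : ℕ) (r : MvPowerSeries (Fin (n + 1)) R) : MvPowerSeries (Fin n) R :=
  fun x => r (Finsupp.cons k x)

theorem coeff_slice {R : Type*} [Semiring R] (k : ℕ) (r : MvPowerSeries (Fin (n + 1)) R)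
    (x : Fin n →₀ ℕ) : coeff x (slice k r) = coeff (Finsupp.cons k x) r :=
  rfl

theorem pow_mul_wnorm_slice_le {𝕜 : Type*} [NormedField 𝕜] (w : Fin (n + 1) → ℝ≥0∞)
    (r : MvPowerSeries (Fin (n + 1)) 𝕜) (k : ℕ) :
    w 0 ^ k * wnorm (fun i => w i.succ) (slice k r) ≤ wnorm w r := by
  have hterm (x : Fin n →₀ ℕ) : w 0 ^ k * (‖coeff x (slice k r)‖ₑ *
      monomialWeight (fun i => w i.succ) x) =
      ‖coeff (Finsupp.cons k x) r‖ₑ * monomialWeight w (Finsupp.cons k x) := by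
    rw [monomialWeight, monomialWeight, Finsupp.prod_fintype _ _ fun _ => pow_zero _,
      Finsupp.prod_fintype _ _ fun _ => pow_zero _, Fin.prod_univ_succ, coeff_slice]
    simp only [Finsupp.cons_zero, Finsupp.cons_succ]
    ring
  rw [wnorm, ← ENNReal.tsum_mul_left]
  simp_rw [hterm]
  exact ENNReal.tsum_comp_le_tsum_of_injective (Finsupp.cons_right_injective k)
    fun m => ‖coeff m r‖ₑ * monomialWeight w m

theorem Convergent.slice {r : MvPowerSeries (Fin (n + 1)) ℂ} (hr : Convergent r) (k : ℕ) :
    Convergent (slice k r) := by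
  obtain ⟨w, hw, hwr⟩ := convergent_iff.1 hr
  refine convergent_iff.2 ⟨fun i => w i.succ, fun i => hw _, fun htop => hwr ?_⟩
  have hle := pow_mul_wnorm_slice_le w r k
  rwa [htop, ENNReal.mul_top (pow_ne_zero _ (hw 0)), top_le_iff] at hle

theorem exists_polyMap_eq {r : MvPowerSeries (Fin (n + 1)) ℂ} (hr : Convergent r) {d : ℕ}
    (hrd : ∀ m, d ≤ m 0 → coeff m r = 0) :
    ∃ R : Polynomial (convSeries n), R.degree < d ∧
      (polyMap R : MvPowerSeries (Fin (n + 1)) ℂ) = r := by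
  let R : Polynomial (convSeries n) :=
    ∑ k ∈ Finset.range d, Polynomial.monomial k ⟨slice k r, hr.slice k⟩
  have hslice {k : ℕ} (hk : d ≤ k) : slice k r = 0 :=
    MvPowerSeries.ext fun x => hrd (Finsupp.cons k x) (by simpa using hk)
  have hR (k : ℕ) : (R.coeff k : MvPowerSeries (Fin n) ℂ) = slice k r := by
    simp only [R, Polynomial.finsetSum_coeff, Polynomial.coeff_monomial, Finset.sum_ite_eq',
      Finset.mem_range]
    split_ifs with hk
    · rfl
    · exact (hslice (not_lt.1 hk)).symm
  refine ⟨R, ?_, ext_cons fun k x => ?_⟩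
  · rw [Polynomial.degree_lt_iff_coeff_zero]
    exact fun k hk => Subtype.ext ((hR k).trans (hslice hk))
  · rw [coeff_polyMap, hR, coeff_slice]

theorem coeff_single_polyMap (R : Polynomial (convSeries n)) (k : ℕ) :
    coeff (Finsupp.single 0 k) (polyMap R : MvPowerSeries (Fin (n + 1)) ℂ) =
      constantCoeff (R.coeff k : MvPowerSeries (Fin n) ℂ) := by
  rw [← Finsupp.cons_zero_eq_single_zero, coeff_polyMap, coeff_zero_eq_constantCoeff_apply]

end polynomials

/-! ### Weierstrass polynomials -/

section weierstrass

variable {n : ℕ} {P : Polynomial (convSeries n)}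

/-- Weierstrass polynomials in `x₀`: the monic polynomials whose other coefficients vanish at the
origin. -/
def IsWeierstrass (P : Polynomial (convSeries n)) : Prop :=
  P.Monic ∧ ∀ k < P.natDegree, constantCoeff (P.coeff k : MvPowerSeries (Fin n) ℂ) = 0

theorem IsWeierstrass.isRegular (hP : IsWeierstrass P) :
    IsRegular 0 (polyMap P : MvPowerSeries (Fin (n + 1)) ℂ) P.natDegree := by
  refine ⟨fun k hk => by rw [coeff_single_polyMap, hP.2 k hk], ?_⟩
  rw [coeff_single_polyMap, hP.1.coeff_natDegree]
  simp

theorem IsWeierstrass.exists_eq_mul_add (hP : IsWeierstrass P) (f : convSeries (n + 1)) :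
    ∃ (q : convSeries (n + 1)) (R : Polynomial (convSeries n)),
      f = q * polyMap P + polyMap R ∧ R.degree < P.degree := by
  obtain ⟨q, r, hq, hr, hfr, hrd⟩ := hP.isRegular.exists_eq_mul_add (polyMap P).2 f.2
  obtain ⟨R, hR, rfl⟩ := exists_polyMap_eq hr hrd
  refine ⟨⟨q, hq⟩, R, Subtype.ext hfr, ?_⟩
  rwa [Polynomial.degree_eq_natDegree hP.1.ne_zero]

theorem IsWeierstrass.eq_zero_of_dvd (hP : IsWeierstrass P) {R : Polynomial (convSeries n)}
    (hR : R.degree < P.degree) (hdvd : polyMap P ∣ polyMap R) : R = 0 := by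
  obtain ⟨q, hq⟩ := hdvd
  have hRd (m : Fin (n + 1) →₀ ℕ) (hm : P.natDegree ≤ m 0) :
      coeff m (polyMap R : MvPowerSeries (Fin (n + 1)) ℂ) = 0 := by
    rw [Polynomial.degree_eq_natDegree hP.1.ne_zero] at hR
    rw [← Finsupp.cons_tail m, coeff_polyMap,
      Polynomial.coeff_eq_zero_of_degree_lt (hR.trans_le (mod_cast hm))]
    simp
  have hq0 : q = 0 := Subtype.ext <| hP.isRegular.eq_zero_of_mul_eq (polyMap P).2 q.2
    (congrArg Subtype.val ((mul_comm _ _).trans hq.symm)) hRd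
  rw [hq0, mul_zero] at hq
  exact polyMap_injective (hq.trans (map_zero polyMap).symm)

theorem IsWeierstrass.dvd_iff (hP : IsWeierstrass P) (R : Polynomial (convSeries n)) :
    polyMap P ∣ polyMap R ↔ P ∣ R := by
  refine ⟨fun hdvd => ?_, map_dvd polyMap⟩
  rw [← Polynomial.modByMonic_eq_zero_iff_dvd hP.1]
  refine hP.eq_zero_of_dvd (Polynomial.degree_modByMonic_lt _ hP.1) ?_
  rw [← Polynomial.modByMonic_add_div R P, map_add, map_mul] at hdvd
  exact (dvd_add_left (dvd_mul_right _ _)).1 hdvd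

theorem isWeierstrass_X_pow_sub {d : ℕ} {R : Polynomial (convSeries n)} (hR : R.degree < d)
    (hR0 : ∀ k < d, constantCoeff (R.coeff k : MvPowerSeries (Fin n) ℂ) = 0) :
    IsWeierstrass (Polynomial.X ^ d - R) := by
  have hdeg : (Polynomial.X ^ d - R).natDegree = d := by
    refine Polynomial.natDegree_eq_of_degree_eq_some ?_
    rw [Polynomial.degree_sub_eq_left_of_degree_lt (by rwa [Polynomial.degree_X_pow]),
      Polynomial.degree_X_pow]
  refine ⟨Polynomial.monic_X_pow_sub hR, fun k hk => ?_⟩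
  rw [hdeg] at hk
  rw [Polynomial.coeff_sub, Polynomial.coeff_X_pow, if_neg hk.ne, zero_sub, NegMemClass.coe_neg,
    map_neg, hR0 k hk, neg_zero]

/-- Divide `x₀ ^ d` by `h`: the Weierstrass polynomial is `x₀ ^ d` minus the remainder. -/
theorem IsRegular.exists_isWeierstrass {h : convSeries (n + 1)} {d : ℕ}
    (hr : IsRegular 0 (h : MvPowerSeries (Fin (n + 1)) ℂ) d) :
    ∃ P : Polynomial (convSeries n), IsWeierstrass P ∧ Associated h (polyMap P) := by
  obtain ⟨q, r, hq, hrc, hqr, hrd⟩ := hr.exists_eq_mul_add h.2 (coord 0 ^ d).2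
  obtain ⟨R, hR, rfl⟩ := exists_polyMap_eq hrc hrd
  have haxis {k : ℕ} (hk : k ≤ d) : (if k = d then 1 else 0 : ℂ) = constantCoeff q *
      coeff (Finsupp.single 0 k) (h : MvPowerSeries (Fin (n + 1)) ℂ) +
        constantCoeff (R.coeff k : MvPowerSeries (Fin n) ℂ) := by
    rw [← hr.coeff_single_mul q hk, ← coeff_single_polyMap, ← map_add, ← hqr,
      SubmonoidClass.coe_pow, coe_coord, coeff_X_pow]
    simp only [(Finsupp.single_injective (0 : Fin (n + 1))).eq_iff]
  have hq0 : constantCoeff q ≠ 0 := by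
    intro h0
    simpa [h0, Polynomial.coeff_eq_zero_of_degree_lt hR] using haxis le_rfl
  have hR0 (k : ℕ) (hk : k < d) : constantCoeff (R.coeff k : MvPowerSeries (Fin n) ℂ) = 0 := by
    simpa [hk.ne, hr.1 k hk] using (haxis hk.le).symm
  lift q to convSeries (n + 1) using hq
  have hsub : polyMap (Polynomial.X ^ d - R) = q * h := by
    have hXd : coord 0 ^ d = q * h + polyMap R := Subtype.ext hqr
    rw [map_sub polyMap, map_pow, polyMap_X, hXd, add_sub_cancel_right]
  exact ⟨Polynomial.X ^ d - R, isWeierstrass_X_pow_sub hR hR0,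
    hsub ▸ associated_unit_mul_right h q ((isUnit_iff q).2 hq0)⟩

end weierstrass

/-! ### Linear changes of coordinates -/

section chain_rule

variable {R σ τ : Type*} [CommRing R]

open WithPiTopology in
theorem continuous_pderiv [TopologicalSpace R] [IsTopologicalRing R] (i : σ) :
    Continuous (MvPowerSeries.pderiv R i) := by
  refine continuous_pi fun d => ?_
  change Continuous fun f => coeff d (MvPowerSeries.pderiv R i f)
  simp_rw [coeff_pderiv]
  exact (continuous_coeff R _).mul continuous_const

theorem pderiv_map_coe [Fintype σ] (φ : MvPowerSeries σ R →ₐ[R] MvPowerSeries τ R) (k : τ)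
    (p : MvPolynomial σ R) :
    MvPowerSeries.pderiv R k (φ p) =
      ∑ j, φ (MvPowerSeries.pderiv R j p) * MvPowerSeries.pderiv R k (φ (X j)) := by
  classical
  induction p using MvPolynomial.induction_on with
  | C c =>
    have hC : φ (C c) = C c := φ.commutes c
    simp [MvPolynomial.coe_C, hC]
  | add p q hp hq =>
    simp only [MvPolynomial.coe_add, map_add, hp, hq, add_mul, Finset.sum_add_distrib]
  | mul_X p i hp =>
    simp only [MvPolynomial.coe_mul, MvPolynomial.coe_X, map_mul, Derivation.leibniz, hp,
      smul_eq_mul, map_add, add_mul, Finset.sum_add_distrib, MvPowerSeries.pderiv_X,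
      Finset.mul_sum]
    congr 1
    · rw [Finset.sum_eq_single i fun j _ hj => by simp [hj.symm]] <;> simp
    · exact Finset.sum_congr rfl fun j _ => by ring

open WithPiTopology in
theorem pderiv_subst [Fintype σ] {a : σ → MvPowerSeries τ R} (ha : HasSubst a) (k : τ)
    (f : MvPowerSeries σ R) :
    MvPowerSeries.pderiv R k (subst a f) =
      ∑ j, subst a (MvPowerSeries.pderiv R j f) * MvPowerSeries.pderiv R k (a j) := by
  let _ : UniformSpace R := ⊥
  have _ : DiscreteUniformity R := ⟨rfl⟩
  have hsubst := continuous_subst (R := R) ha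
  have hleft : Continuous fun f : MvPowerSeries σ R => MvPowerSeries.pderiv R k (subst a f) :=
    (continuous_pderiv k).comp hsubst
  have hright : Continuous fun f : MvPowerSeries σ R =>
      ∑ j, subst a (MvPowerSeries.pderiv R j f) * MvPowerSeries.pderiv R k (a j) :=
    continuous_finsetSum _ fun j _ => (hsubst.comp (continuous_pderiv j)).mul continuous_const
  refine congrFun (denseRange_toMvPowerSeries.equalizer hleft hright (funext fun p => ?_)) f
  have hpoly := pderiv_map_coe (substAlgHom (R := R) ha) k p
  simp only [substAlgHom_X, coe_substAlgHom] at hpoly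
  exact hpoly

end chain_rule

section linear

variable {n p q : ℕ}

/-- A linear form on `ℂⁿ`, as a convergent power series. -/
def linForm (φ : Module.Dual ℂ (Fin n → ℂ)) : convSeries n :=
  ∑ j, φ (Pi.single j 1) • coord j

theorem coe_linForm (φ : Module.Dual ℂ (Fin n → ℂ)) :
    (linForm φ : MvPowerSeries (Fin n) ℂ) = ∑ j, C (φ (Pi.single j 1)) * X j := by
  simp [linForm, smul_eq_C_mul]

theorem constantCoeff_linForm (φ : Module.Dual ℂ (Fin n → ℂ)) :
    constantCoeff (linForm φ : MvPowerSeries (Fin n) ℂ) = 0 := by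
  simp [coe_linForm]

theorem apply_eq_sum_single (φ : Module.Dual ℂ (Fin n → ℂ)) (z : Fin n → ℂ) :
    φ z = ∑ j, φ (Pi.single j 1) * z j := by
  conv_lhs => rw [pi_eq_sum_univ' z, map_sum]
  simp [mul_comm]

theorem wnorm_linForm_le (φ : Module.Dual ℂ (Fin n → ℂ)) (w : Fin n → ℝ≥0∞) :
    wnorm w (linForm φ : MvPowerSeries (Fin n) ℂ) ≤ ∑ j, ‖φ (Pi.single j 1)‖ₑ * w j := by
  rw [coe_linForm]
  refine (wnorm_sum_le _ _ _).trans (Finset.sum_le_sum fun j _ => ?_)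
  exact (wnorm_mul_le _ _ _).trans_eq (by rw [wnorm_C, wnorm_X])

theorem linForm_mem_convergentAt (φ : Module.Dual ℂ (Fin n → ℂ)) (z : Fin n → ℂ) :
    (linForm φ : MvPowerSeries (Fin n) ℂ) ∈ convergentAt z := by
  refine ne_top_of_le_ne_top ?_ (wnorm_linForm_le φ _)
  simp [ENNReal.sum_eq_top, ENNReal.mul_eq_top]

theorem value_linForm (φ : Module.Dual ℂ (Fin n → ℂ)) (z : Fin n → ℂ) :
    value (linForm φ) z = φ z := by
  have hsum := map_sum (evalAt z)
    (fun j => φ (Pi.single j 1) • (⟨X j, X_mem_convergentAt j⟩ : convergentAt z)) Finset.univ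
  simp only [map_smul, evalAt_apply, sumAt_X, AddSubmonoidClass.coe_finsetSum] at hsum
  rw [value_eq_sumAt, apply_eq_sum_single φ z, linForm, AddSubmonoidClass.coe_finsetSum]
  exact hsum

theorem pderiv_linForm (φ : Module.Dual ℂ (Fin n → ℂ)) (k : Fin n) :
    MvPowerSeries.pderiv ℂ k (linForm φ : MvPowerSeries (Fin n) ℂ) = C (φ (Pi.single k 1)) := by
  rw [coe_linForm, map_sum, Finset.sum_eq_single k]
  · simp [Derivation.leibniz, pderiv_X_self]
  · intro l _ hl
    simp [Derivation.leibniz, pderiv_X_of_ne hl]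
  · simp

/-- Precomposition with a linear map. -/
def linChange (A : (Fin n → ℂ) →ₗ[ℂ] (Fin p → ℂ)) : convSeries p →ₐ[ℂ] convSeries n :=
  substConv (fun i => linForm (LinearMap.proj i ∘ₗ A)) fun _ => constantCoeff_linForm _

theorem coe_linChange (A : (Fin n → ℂ) →ₗ[ℂ] (Fin p → ℂ)) (f : convSeries p) :
    (linChange A f : MvPowerSeries (Fin n) ℂ) =
      subst (fun i => (linForm (LinearMap.proj i ∘ₗ A) : MvPowerSeries (Fin n) ℂ))
        (f : MvPowerSeries (Fin p) ℂ) :=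
  coe_substConv f

theorem hasSubst_linForm (A : (Fin n → ℂ) →ₗ[ℂ] (Fin p → ℂ)) :
    HasSubst fun i => (linForm (LinearMap.proj i ∘ₗ A) : MvPowerSeries (Fin n) ℂ) :=
  hasSubst_of_constantCoeff_zero fun _ => constantCoeff_linForm _

theorem linChange_coord (A : (Fin n → ℂ) →ₗ[ℂ] (Fin p → ℂ)) (i : Fin p) :
    linChange A (coord i) = linForm (LinearMap.proj i ∘ₗ A) :=
  Subtype.ext (by rw [coe_linChange, coe_coord, subst_X (hasSubst_linForm A)])

theorem linChange_linForm (A : (Fin n → ℂ) →ₗ[ℂ] (Fin p → ℂ)) (φ : Module.Dual ℂ (Fin p → ℂ)) :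
    linChange A (linForm φ) = linForm (φ ∘ₗ A) := by
  rw [linForm, map_sum]
  simp only [map_smul, linChange_coord, linForm, Finset.smul_sum, smul_smul, LinearMap.comp_apply,
    LinearMap.proj_apply]
  rw [Finset.sum_comm]
  simp only [← Finset.sum_smul, ← apply_eq_sum_single]

theorem linChange_linChange (A : (Fin n → ℂ) →ₗ[ℂ] (Fin p → ℂ))
    (B : (Fin p → ℂ) →ₗ[ℂ] (Fin q → ℂ)) (f : convSeries q) :
    linChange A (linChange B f) = linChange (B ∘ₗ A) f := by
  refine Subtype.ext ?_
  rw [coe_linChange, coe_linChange, coe_linChange,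
    subst_comp_subst_apply (hasSubst_linForm B) (hasSubst_linForm A)]
  simp only [← coe_linChange, linChange_linForm, LinearMap.comp_assoc]

theorem linChange_id (f : convSeries n) : linChange LinearMap.id f = f := by
  have hX : (fun i => (linForm (LinearMap.proj i ∘ₗ LinearMap.id) : MvPowerSeries (Fin n) ℂ)) =
      X := by
    funext i
    simp [coe_linForm, Pi.single_apply]
  refine Subtype.ext ?_
  rw [coe_linChange, hX, subst_self, id_eq]

/-- Precomposition with an invertible linear map. -/
def linEquiv (A : (Fin n → ℂ) ≃ₗ[ℂ] (Fin p → ℂ)) : convSeries p ≃ₐ[ℂ] convSeries n :=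
  AlgEquiv.ofAlgHom (linChange A.toLinearMap) (linChange A.symm.toLinearMap)
    (AlgHom.ext fun f => by simp [linChange_linChange, linChange_id])
    (AlgHom.ext fun f => by simp [linChange_linChange, linChange_id])

theorem linEquiv_apply (A : (Fin n → ℂ) ≃ₗ[ℂ] (Fin p → ℂ)) (f : convSeries p) :
    linEquiv A f = linChange A.toLinearMap f :=
  rfl

theorem eventually_value_linEquiv (A : (Fin n → ℂ) ≃ₗ[ℂ] (Fin p → ℂ)) (f : convSeries p) :
    ∀ᶠ z in 𝓝 (0 : Fin n → ℂ), value (linEquiv A f) z = value f (A z) := by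
  filter_upwards [eventually_value_substConv (ha := fun _ => constantCoeff_linForm _) f] with z hz
  rw [linEquiv_apply, linChange, hz]
  simp only [value_linForm]
  rfl

theorem pd_linEquiv (A : (Fin n → ℂ) ≃ₗ[ℂ] (Fin p → ℂ)) (k : Fin n) (f : convSeries p) :
    pd k (linEquiv A f) = ∑ j, A (Pi.single k 1) j • linEquiv A (pd j f) := by
  refine Subtype.ext ?_
  simp only [linEquiv_apply, coe_pd, coe_linChange, pderiv_subst (hasSubst_linForm _),
    pderiv_linForm, AddSubmonoidClass.coe_finsetSum, SetLike.val_smul, smul_eq_C_mul]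
  exact Finset.sum_congr rfl fun j _ => mul_comm _ _

theorem sumAt_single_eq_zero {σ 𝕜 : Type*} [DecidableEq σ] [NormedField 𝕜] {i : σ}
    {f : MvPowerSeries σ 𝕜} (hf : ∀ k, coeff (Finsupp.single i k) f = 0) (c : 𝕜) :
    sumAt f (Pi.single i c) = 0 := by
  refine (tsum_congr fun m => ?_).trans tsum_zero
  by_cases hm : m.support ⊆ {i}
  · obtain ⟨k, rfl⟩ := Finsupp.support_subset_singleton'.1 hm
    rw [hf, zero_mul]
  · obtain ⟨j, hj, hji⟩ := Finset.not_subset.1 hm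
    rw [Finsupp.prod, Finset.prod_eq_zero hj, mul_zero]
    rw [Pi.single_eq_of_ne (by simpa using hji), zero_pow (Finsupp.mem_support_iff.1 hj)]

/-- It is enough that `h` does not vanish at some point `b ≠ 0` of its domain of convergence: the
change of coordinates sends the first basis vector to `b`. -/
theorem exists_linEquiv_isRegular {h : convSeries (n + 1)} (h0 : h ≠ 0) (hu : ¬ IsUnit h) :
    ∃ (A : (Fin (n + 1) → ℂ) ≃L[ℂ] (Fin (n + 1) → ℂ)) (d : ℕ),
      IsRegular 0 (linEquiv A.toLinearEquiv h : MvPowerSeries (Fin (n + 1)) ℂ) d := by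
  obtain ⟨w, hw, hhw⟩ := convergent_iff.1 h.2
  have hfreq : ∃ᶠ z in 𝓝 (0 : Fin (n + 1) → ℂ), value h z ≠ 0 := fun hev =>
    h0 (eq_zero_of_eventually_value_eq_zero (hev.mono fun z hz => not_not.1 hz))
  obtain ⟨b, hb, hbw⟩ := (hfreq.and_eventually (eventually_enorm_le hw)).exists
  have hb0 : b ≠ 0 := by
    rintro rfl
    exact hu ((isUnit_iff h).2 (value_zero_right h ▸ hb))
  obtain ⟨A, hA⟩ := SeparatingDual.exists_continuousLinearEquiv_apply_eq (R := ℂ)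
    (x := (Pi.single 0 1 : Fin (n + 1) → ℂ)) (by simp) hb0
  have hvalue : value (linEquiv A.toLinearEquiv h) (Pi.single 0 1) = value h b := by
    rw [linEquiv_apply, linChange, value_substConv fun i => linForm_mem_convergentAt _ _]
    · simp only [value_linForm, ← hA]
      rfl
    · refine ne_top_of_le_ne_top hhw (wnorm_mono (fun i => ?_) _)
      refine (wnorm_linForm_le _ _).trans (le_of_eq_of_le ?_ (hbw i))
      rw [Finset.sum_eq_single 0 fun j _ hj => by simp [hj]] <;> simp [hA]
  have hex : ∃ k, coeff (Finsupp.single 0 k)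
      (linEquiv A.toLinearEquiv h : MvPowerSeries (Fin (n + 1)) ℂ) ≠ 0 := by
    by_contra! hcon
    exact hb (hvalue.symm.trans (sumAt_single_eq_zero hcon 1))
  classical
  exact ⟨A, Nat.find hex, fun k hk => not_not.1 (Nat.find_min hex hk), Nat.find_spec hex⟩

end linear

/-! ### Unique factorization -/

section factorization

variable {n : ℕ}

theorem prime_map_of_division {A B : Type*} [CommRing A] [CommRing B] (φ : A →+* B) {p : A}
    (hp : Prime p) (h0 : φ p ≠ 0) (hdiv : ∀ b, ∃ q r, b = q * φ p + φ r)
    (hdvd : ∀ r, φ p ∣ φ r → p ∣ r) : Prime (φ p) := by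
  refine ⟨h0, fun hu => hp.not_isUnit ?_, fun a b hab => ?_⟩
  · exact isUnit_of_dvd_one (hdvd 1 (by rw [map_one]; exact hu.dvd))
  · obtain ⟨q₁, r₁, rfl⟩ := hdiv a
    obtain ⟨q₂, r₂, rfl⟩ := hdiv b
    have hprod : (q₁ * φ p + φ r₁) * (q₂ * φ p + φ r₂) =
        φ p * (q₁ * (q₂ * φ p + φ r₂) + q₂ * φ r₁) + φ (r₁ * r₂) := by
      rw [map_mul]
      ring
    rw [hprod, dvd_add_right (dvd_mul_right _ _)] at hab
    rcases hp.dvd_or_dvd (hdvd _ hab) with hr | hr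
    · exact Or.inl (dvd_add (dvd_mul_left _ _) (map_dvd φ hr))
    · exact Or.inr (dvd_add (dvd_mul_left _ _) (map_dvd φ hr))

instance : IsDomain (MvPowerSeries (Fin n) ℂ) := NoZeroDivisors.to_isDomain _

instance : IsDomain (convSeries n) := inferInstance

/-- The value at the origin, as a ring homomorphism. -/
def evalZero : convSeries n →+* ℂ :=
  (constantCoeff (σ := Fin n) (R := ℂ)).comp (convSeries n).val.toRingHom

theorem evalZero_ne_zero_iff {f : convSeries n} : evalZero f ≠ 0 ↔ IsUnit f :=
  (isUnit_iff f).symm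

theorem IsWeierstrass.map_evalZero {P : Polynomial (convSeries n)} (hP : IsWeierstrass P) :
    P.map evalZero = Polynomial.X ^ P.natDegree := by
  ext k
  rw [Polynomial.coeff_map, Polynomial.coeff_X_pow]
  split_ifs with hk
  · rw [hk, hP.1.coeff_natDegree, map_one]
  · rcases lt_or_gt_of_ne hk with h | h
    · exact hP.2 k h
    · rw [Polynomial.coeff_eq_zero_of_natDegree_lt h, map_zero]

/-- Modulo the maximal ideal `f` divides a power of the variable, hence is itself such a power. -/
theorem IsWeierstrass.eq_one_of_isUnit {P f : Polynomial (convSeries n)} (hP : IsWeierstrass P)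
    (hf : f.Monic) (hfP : f ∣ P) (hu : IsUnit (polyMap f)) : f = 1 := by
  have h0 : evalZero (f.coeff 0) ≠ 0 := by
    rw [evalZero_ne_zero_iff, isUnit_iff, ← coeff_single_polyMap, Finsupp.single_zero]
    exact (isUnit_iff _).1 hu
  have hdvd : f.map evalZero ∣ Polynomial.X ^ P.natDegree :=
    hP.map_evalZero ▸ Polynomial.map_dvd evalZero hfP
  obtain ⟨i, -, hi⟩ := (dvd_prime_pow Polynomial.prime_X _).1 hdvd
  obtain rfl : i = 0 := by
    by_contra hne
    have hX : Polynomial.X ∣ f.map evalZero := (dvd_pow_self _ hne).trans hi.symm.dvd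
    rw [Polynomial.X_dvd_iff, Polynomial.coeff_map] at hX
    exact h0 hX
  rw [pow_zero, associated_one_iff_isUnit] at hi
  rw [← hf.natDegree_eq_zero, ← hf.natDegree_map (evalZero (n := n))]
  exact Polynomial.natDegree_eq_zero_of_isUnit hi

theorem IsWeierstrass.natDegree_ne_zero {P : Polynomial (convSeries n)} (hP : IsWeierstrass P)
    (hu : ¬ IsUnit (polyMap P)) : P.natDegree ≠ 0 := fun hd => hu (by
  rw [hP.1.natDegree_eq_zero.1 hd, map_one]
  exact isUnit_one)

theorem IsWeierstrass.irreducible {P : Polynomial (convSeries n)} (hP : IsWeierstrass P)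
    (h : Irreducible (polyMap P)) : Irreducible P := by
  rw [hP.1.irreducible_iff_natDegree]
  refine ⟨fun h1 => h.not_isUnit (by rw [h1, map_one]; exact isUnit_one), fun f g hf hg hfg => ?_⟩
  have hmul : polyMap P = polyMap f * polyMap g := by rw [← hfg, map_mul]
  refine (h.isUnit_or_isUnit hmul).imp (fun hu => ?_) fun hu => ?_
  · rw [hP.eq_one_of_isUnit hf (Dvd.intro _ hfg) hu, Polynomial.natDegree_one]
  · rw [hP.eq_one_of_isUnit hg (Dvd.intro_left _ hfg) hu, Polynomial.natDegree_one]

theorem IsWeierstrass.prime [UniqueFactorizationMonoid (convSeries n)]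
    {P : Polynomial (convSeries n)} (hP : IsWeierstrass P) (h : Irreducible (polyMap P)) :
    Prime (polyMap P) :=
  prime_map_of_division polyMap
    (UniqueFactorizationMonoid.irreducible_iff_prime.1 (hP.irreducible h)) h.ne_zero
    (fun f => (hP.exists_eq_mul_add f).imp fun _ ⟨R, hf, _⟩ => ⟨R, hf⟩) fun R => (hP.dvd_iff R).1

theorem exists_linEquiv_isWeierstrass {h : convSeries (n + 1)} (h0 : h ≠ 0) (hu : ¬ IsUnit h) :
    ∃ (A : (Fin (n + 1) → ℂ) ≃L[ℂ] (Fin (n + 1) → ℂ)) (P : Polynomial (convSeries n)),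
      IsWeierstrass P ∧ Associated (linEquiv A.toLinearEquiv h) (polyMap P) := by
  obtain ⟨A, d, hd⟩ := exists_linEquiv_isRegular h0 hu
  exact ⟨A, hd.exists_isWeierstrass⟩

theorem order_lt_order_of_dvdNotUnit {a b : convSeries n} (h : DvdNotUnit a b) :
    (a : MvPowerSeries (Fin n) ℂ).order < (b : MvPowerSeries (Fin n) ℂ).order := by
  obtain ⟨ha, x, hx, rfl⟩ := h
  have ha_order : (a : MvPowerSeries (Fin n) ℂ).order ≠ ⊤ := by
    rw [ne_eq, order_eq_top_iff]
    exact fun h0 => ha (Subtype.ext h0)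
  have hx_order : (x : MvPowerSeries (Fin n) ℂ).order ≠ 0 := by
    rw [order_ne_zero_iff_constCoeff_eq_zero]
    by_contra h0
    exact hx ((isUnit_iff x).2 h0)
  rw [MulMemClass.coe_mul, order_mul]
  simpa using (ENat.add_lt_add_iff_left ha_order).2 (pos_iff_ne_zero.2 hx_order)

instance : WfDvdMonoid (convSeries n) :=
  ⟨Subrelation.wf (r := InvImage (· < ·) fun a : convSeries n =>
      (a : MvPowerSeries (Fin n) ℂ).order) order_lt_order_of_dvdNotUnit
    (InvImage.wf _ wellFounded_lt)⟩

theorem not_irreducible_of_isEmpty (h : convSeries 0) : ¬ Irreducible h := fun hh => by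
  refine hh.not_isUnit ((isUnit_iff h).2 fun h0 => hh.ne_zero ?_)
  refine Subtype.ext (MvPowerSeries.ext fun m => ?_)
  rw [Subsingleton.elim m 0]
  exact h0

instance : UniqueFactorizationMonoid (convSeries n) := by
  induction n with
  | zero => exact ⟨⟨fun hh => (not_irreducible_of_isEmpty _ hh).elim, Prime.irreducible⟩⟩
  | succ n ih =>
    refine ⟨⟨fun hh => ?_, Prime.irreducible⟩⟩
    obtain ⟨A, P, hP, hPh⟩ := exists_linEquiv_isWeierstrass hh.ne_zero hh.not_isUnit
    have hirr : Irreducible (polyMap P) :=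
      hPh.irreducible_iff.1 ((MulEquiv.irreducible_iff (linEquiv A.toLinearEquiv)).2 hh)
    exact (MulEquiv.prime_iff (linEquiv A.toLinearEquiv)).1 (hPh.prime_iff.2 (hP.prime hirr))

end factorization

section integrality

variable {n : ℕ}

instance : Algebra (convSeries n) (convSeries (n + 1)) := lift.toRingHom.toAlgebra

/-- By Weierstrass division the quotient is generated by the class of the first variable. -/
theorem IsWeierstrass.isIntegral {P : Polynomial (convSeries n)} (hP : IsWeierstrass P) :
    Algebra.IsIntegral (convSeries n) (convSeries (n + 1) ⧸ Ideal.span {polyMap P}) where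
  isIntegral x := by
    obtain ⟨f, rfl⟩ := Ideal.Quotient.mk_surjective x
    set I := Ideal.span {polyMap P}
    have hmk : ∀ R, Ideal.Quotient.mk I (polyMap R) =
        Polynomial.aeval (Ideal.Quotient.mk I (coord 0)) R := fun R =>
      (Polynomial.aeval_algHom_apply (Ideal.Quotient.mkₐ (convSeries n) I) (coord 0) R).symm
    have hcoord : IsIntegral (convSeries n) (Ideal.Quotient.mk I (coord 0)) :=
      ⟨P, hP.1, (hmk P).symm.trans (Ideal.Quotient.eq_zero_iff_mem.2
        (Ideal.mem_span_singleton_self _))⟩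
    obtain ⟨q, R, rfl, -⟩ := hP.exists_eq_mul_add f
    have hq : Ideal.Quotient.mk I (q * polyMap P) = 0 :=
      Ideal.Quotient.eq_zero_iff_mem.2 (Ideal.mul_mem_left _ _ (Ideal.mem_span_singleton_self _))
    rw [map_add, hq, zero_add, hmk]
    exact adjoin_le_integralClosure (A := convSeries (n + 1) ⧸ I) hcoord
      (Polynomial.aeval_mem_adjoin_singleton _ _)

instance : SMul (convSeries n) (convSeries (n + 1)) := Algebra.toSMul

instance : IsScalarTower ℂ (convSeries n) (convSeries (n + 1)) :=
  .of_algebraMap_eq fun c => (lift.commutes c).symm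

end integrality

/-! ### The Nullstellensatz for irreducible hypersurface germs -/

theorem exists_root_norm_lt {p : Polynomial ℂ} (hp : p.Monic) {ε : ℝ} (hε : 0 ≤ ε)
    (h : ‖p.coeff 0‖ < ε ^ p.natDegree) : ∃ z, ‖z‖ < ε ∧ p.IsRoot z := by
  have hsplits := IsAlgClosed.splits p
  by_contra! hroots
  refine h.not_ge ?_
  calc ε ^ p.natDegree = (p.roots.map fun _ => ε).prod := by
        rw [Multiset.map_const', Multiset.prod_replicate, hsplits.natDegree_eq_card_roots]
    _ ≤ (p.roots.map norm).prod := Multiset.prod_map_le_prod_map₀ _ _ (fun _ _ => hε)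
        fun z hz => not_lt.1 fun hlt => hroots z hlt (Polynomial.isRoot_of_mem_roots hz)
    _ = ‖p.roots.prod‖ := (map_multiset_prod (normHom (α := ℂ)) p.roots).symm
    _ = ‖p.coeff 0‖ := by simp [hsplits.coeff_zero_eq_prod_roots_of_monic hp]

section specialization

variable {n : ℕ} {P : Polynomial (convSeries n)}

theorem tendsto_value_zero {f : convSeries n}
    (hf : constantCoeff (f : MvPowerSeries (Fin n) ℂ) = 0) :
    Tendsto (value f) (𝓝 0) (𝓝 0) := by
  refine EMetric.tendsto_nhds.2 fun ε hε => ?_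
  obtain ⟨δ, hδ, hδε⟩ := exists_between hε
  obtain ⟨w, hw, hfw⟩ := f.2.exists_wnorm_le hf hδ.ne'
  filter_upwards [eventually_enorm_le hw] with z hz
  rw [edist_zero_right]
  refine lt_of_le_of_lt (enorm_tsum_le_tsum_enorm.trans ?_) hδε
  rw [← wnorm_enorm_eq_tsum]
  exact (wnorm_mono hz _).trans hfw

/-- The polynomial over `ℂ` obtained by evaluating the coefficients of `P` at `y`; a coefficient
diverging at `y` is evaluated to the junk value of `value`. -/
def specialize (P : Polynomial (convSeries n)) (y : Fin n → ℂ) : Polynomial ℂ :=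
  P.sum fun k a => Polynomial.monomial k (value a y)

theorem coeff_specialize (P : Polynomial (convSeries n)) (y : Fin n → ℂ) (k : ℕ) :
    (specialize P y).coeff k = value (P.coeff k) y := by
  rw [specialize, Polynomial.sum_def, Polynomial.finsetSum_coeff]
  simp only [Polynomial.coeff_monomial, Finset.sum_ite_eq', ite_eq_left_iff]
  intro hk
  rw [Polynomial.notMem_support_iff.1 hk, value_zero]

theorem natDegree_specialize_le (P : Polynomial (convSeries n)) (y : Fin n → ℂ) :
    (specialize P y).natDegree ≤ P.natDegree := by
  refine Polynomial.natDegree_le_iff_coeff_eq_zero.2 fun k hk => ?_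
  rw [coeff_specialize, Polynomial.coeff_eq_zero_of_natDegree_lt hk, value_zero]

theorem coeff_specialize_natDegree (hP : P.Monic) (y : Fin n → ℂ) :
    (specialize P y).coeff P.natDegree = 1 := by
  rw [coeff_specialize, hP.coeff_natDegree]
  exact (congrArg (sumAt · y) (map_one C).symm).trans (sumAt_C 1)

theorem natDegree_specialize (hP : P.Monic) (y : Fin n → ℂ) :
    (specialize P y).natDegree = P.natDegree :=
  (natDegree_specialize_le P y).antisymm (Polynomial.le_natDegree_of_ne_zero
    ((coeff_specialize_natDegree hP y).trans_ne one_ne_zero))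

theorem monic_specialize (hP : P.Monic) (y : Fin n → ℂ) : (specialize P y).Monic :=
  Polynomial.monic_of_natDegree_le_of_coeff_eq_one _ (natDegree_specialize_le P y)
    (coeff_specialize_natDegree hP y)

theorem eventually_value_polyMap_eq_eval (R : Polynomial (convSeries n)) :
    ∀ᶠ z in 𝓝 (0 : Fin (n + 1) → ℂ),
      value (polyMap R) z = (specialize R (Fin.tail z)).eval (z 0) := by
  filter_upwards [eventually_value_polyMap R] with z hz
  rw [hz, Polynomial.eval_eq_sum_range' (Nat.lt_succ_of_le (natDegree_specialize_le R _))]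
  simp only [coeff_specialize]

theorem IsWeierstrass.eventually_exists_root (hP : IsWeierstrass P) (hd : P.natDegree ≠ 0) {ε : ℝ}
    (hε : 0 < ε) : ∀ᶠ y in 𝓝 (0 : Fin n → ℂ), ∃ t, ‖t‖ < ε ∧ (specialize P y).IsRoot t := by
  have hcoeff := tendsto_value_zero (hP.2 0 (Nat.pos_of_ne_zero hd))
  filter_upwards [hcoeff.norm.eventually_lt_const (by simpa using pow_pos hε P.natDegree)] with y hy
  refine exists_root_norm_lt (monic_specialize hP.1 y) hε.le ?_
  rwa [coeff_specialize, natDegree_specialize hP.1]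

theorem mem_zeros_singleton {f : convSeries n} {z : Fin n → ℂ} :
    z ∈ zeros {f} ↔ value f z = 0 :=
  forall_eq

theorem IsWeierstrass.nhds_le_map_tail (hP : IsWeierstrass P) (hd : P.natDegree ≠ 0) :
    𝓝 (0 : Fin n → ℂ) ≤ map Fin.tail (𝓝[zeros {polyMap P}] (0 : Fin (n + 1) → ℂ)) := by
  intro s hs
  obtain ⟨ε, hε, hball⟩ := Metric.eventually_nhds_iff.1
    ((eventually_nhdsWithin_iff.1 hs).and (eventually_value_polyMap_eq_eval P))
  filter_upwards [hP.eventually_exists_root hd hε, Metric.ball_mem_nhds 0 hε]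
    with y ⟨t, ht, hroot⟩ hy
  have hdist : dist (Fin.cons t y : Fin (n + 1) → ℂ) 0 < ε := by
    rw [dist_zero_right, pi_norm_lt_iff hε, Fin.forall_fin_succ]
    exact ⟨ht, fun i => (norm_le_pi_norm y i).trans_lt (by simpa using hy)⟩
  obtain ⟨hmem, hvalue⟩ := hball hdist
  exact hmem (mem_zeros_singleton.2 (hvalue.trans hroot))

end specialization

section nullstellensatz

variable {n : ℕ}

/-- The ideal of the convergent power series vanishing on the germ at the origin of the set `X`. -/
def vanishingIdeal (X : Set (Fin n → ℂ)) : Ideal (convSeries n) where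
  carrier := {f | X ≤ᶠ[𝓝 0] zeros {f}}
  zero_mem' := Eventually.of_forall fun z _ => mem_zeros_singleton.2 (value_zero z)
  add_mem' {f g} hf hg := by
    filter_upwards [hf, hg, eventually_value_add f g] with z hfz hgz hadd hz
    exact mem_zeros_singleton.2 (by
      rw [hadd, mem_zeros_singleton.1 (hfz hz), mem_zeros_singleton.1 (hgz hz), add_zero])
  smul_mem' a f hf := by
    filter_upwards [hf, eventually_value_mul a f] with z hfz hmul hz
    exact mem_zeros_singleton.2 (by
      rw [smul_eq_mul, hmul, mem_zeros_singleton.1 (hfz hz), mul_zero])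

variable {X Y : Set (Fin n → ℂ)}

theorem mem_vanishingIdeal {f : convSeries n} : f ∈ vanishingIdeal X ↔ X ≤ᶠ[𝓝 0] zeros {f} :=
  Iff.rfl

theorem vanishingIdeal_anti (h : X ≤ᶠ[𝓝 0] Y) : vanishingIdeal Y ≤ vanishingIdeal X :=
  fun _ hf => h.trans hf

theorem span_le_vanishingIdeal_zeros (f : convSeries n) :
    Ideal.span {f} ≤ vanishingIdeal (zeros {f}) :=
  (Ideal.span_singleton_le_iff_mem _).2 (mem_vanishingIdeal.2 EventuallyLE.rfl)

theorem zeros_linEquiv {p : ℕ} (A : (Fin n → ℂ) ≃L[ℂ] (Fin p → ℂ)) (f : convSeries p) :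
    zeros {linEquiv A.toLinearEquiv f} =ᶠ[𝓝 0] A ⁻¹' zeros {f} := by
  filter_upwards [eventually_value_linEquiv A.toLinearEquiv f] with z hz
  refine propext ?_
  change z ∈ zeros _ ↔ A z ∈ zeros _
  rw [mem_zeros_singleton, mem_zeros_singleton, hz]
  rfl

theorem zeros_linEquiv_le_zeros_linEquiv {p : ℕ} (A : (Fin n → ℂ) ≃L[ℂ] (Fin p → ℂ))
    {f g : convSeries p} (h : zeros {f} ≤ᶠ[𝓝 0] zeros {g}) :
    zeros {linEquiv A.toLinearEquiv f} ≤ᶠ[𝓝 0] zeros {linEquiv A.toLinearEquiv g} := by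
  have hA : Tendsto A (𝓝 0) (𝓝 0) := by simpa using A.continuous.tendsto 0
  exact ((zeros_linEquiv A f).le.trans (hA.eventually h)).trans (zeros_linEquiv A g).symm.le

theorem IsWeierstrass.vanishingIdeal_zeros {P : Polynomial (convSeries n)} (hP : IsWeierstrass P)
    (hirr : Irreducible (polyMap P)) :
    vanishingIdeal (zeros {polyMap P}) = Ideal.span {polyMap P} := by
  refine le_antisymm (fun f hf => ?_) (span_le_vanishingIdeal_zeros _)
  have hprime : (Ideal.span {polyMap P}).IsPrime :=
    (Ideal.span_singleton_prime hirr.ne_zero).2 (hP.prime hirr)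
  have hd := hP.natDegree_ne_zero hirr.not_isUnit
  obtain ⟨p, hp, hpf⟩ := hP.isIntegral.isIntegral (Ideal.Quotient.mk _ f)
  have hmem : p.eval₂ (algebraMap (convSeries n) (convSeries (n + 1))) f ∈
      Ideal.span {polyMap P} := by
    rw [← Ideal.Quotient.eq_zero_iff_mem, Polynomial.hom_eval₂]
    exact hpf
  by_contra hfP
  obtain ⟨D, hD, hDP⟩ := Set.exists_of_ssubset
    (Ideal.comap_lt_comap_of_root_mem_sdiff (span_le_vanishingIdeal_zeros _) ⟨hf, hfP⟩
      (hp.map _).ne_zero hmem)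
  have hzero : ∀ᶠ y in 𝓝 0, value D y = 0 := by
    refine hP.nhds_le_map_tail hd (eventually_nhdsWithin_iff.2 ?_)
    filter_upwards [hD, eventually_value_lift D] with z hz hlift hzP
    exact hlift.symm.trans (mem_zeros_singleton.1 (hz hzP))
  rw [eq_zero_of_eventually_value_eq_zero hzero] at hDP
  exact hDP (Ideal.zero_mem _)

theorem zeros_le_zeros_of_dvd {f g : convSeries n} (h : f ∣ g) : zeros {f} ≤ᶠ[𝓝 0] zeros {g} :=
  span_le_vanishingIdeal_zeros f (Ideal.mem_span_singleton.2 h)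

theorem zeros_le_zeros_iff {h f : convSeries n} (hh : Irreducible h) :
    zeros {h} ≤ᶠ[𝓝 0] zeros {f} ↔ h ∣ f := by
  refine ⟨fun hle => ?_, zeros_le_zeros_of_dvd⟩
  cases n with
  | zero => exact (not_irreducible_of_isEmpty h hh).elim
  | succ n =>
    obtain ⟨A, P, hP, hPh⟩ := exists_linEquiv_isWeierstrass hh.ne_zero hh.not_isUnit
    have hirr : Irreducible (polyMap P) :=
      hPh.irreducible_iff.1 ((MulEquiv.irreducible_iff (linEquiv A.toLinearEquiv)).2 hh)
    have hf : linEquiv A.toLinearEquiv f ∈ vanishingIdeal (zeros {polyMap P}) :=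
      (zeros_le_zeros_of_dvd hPh.symm.dvd).trans (zeros_linEquiv_le_zeros_linEquiv A hle)
    rw [hP.vanishingIdeal_zeros hirr, Ideal.mem_span_singleton] at hf
    exact (map_dvd_iff (linEquiv A.toLinearEquiv)).1 (hPh.dvd.trans hf)

theorem vanishingIdeal_zeros {h : convSeries n} (hh : Irreducible h) :
    vanishingIdeal (zeros {h}) = Ideal.span {h} := by
  ext f
  rw [mem_vanishingIdeal, zeros_le_zeros_iff hh, Ideal.mem_span_singleton]

end nullstellensatz

section derivation

open scoped Differential

theorem exists_derivation_extension {R S T : Type*} [CommRing R] [CommRing S] [CommRing T]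
    [Algebra R S] [Algebra S T] [Algebra R T] [IsScalarTower R S T] (M : Submonoid S)
    [IsLocalization M T] (d : Derivation R S T) :
    ∃ δ : Derivation R T T, ∀ a, δ (algebraMap S T a) = d a := by
  let l : Ω[T⁄R] →ₗ[S] T := IsLocalizedModule.lift M (KaehlerDifferential.map R R S T)
    d.liftKaehlerDifferential (IsLocalizedModule.map_units (Algebra.linearMap S T))
  refine ⟨(l.extendScalarsOfIsLocalization M T).compDer (KaehlerDifferential.D R T), fun a => ?_⟩
  change l (KaehlerDifferential.D R T (algebraMap S T a)) = d a
  rw [← KaehlerDifferential.map_D R R S T, IsLocalizedModule.lift_apply]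
  exact d.liftKaehlerDifferential_comp_D a

theorem algebraMap_fractionRing_quotient_eq_zero_iff {B : Type*} [CommRing B] {π : B} (b : B) :
    algebraMap B (FractionRing (B ⧸ Ideal.span {π})) b = 0 ↔ π ∣ b := by
  rw [IsScalarTower.algebraMap_apply B (B ⧸ Ideal.span {π}), FaithfulSMul.algebraMap_eq_zero_iff]
  exact Ideal.Quotient.eq_zero_iff_dvd π b

theorem exists_derivation_fractionRing_quotient {R B : Type*} [CommRing R] [CommRing B]
    [Algebra R B] (I : Ideal B) {D : Derivation R B B} (hD : ∀ b ∈ I, D b ∈ I) :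
    ∃ δ : Derivation R (FractionRing (B ⧸ I)) (FractionRing (B ⧸ I)),
      ∀ b, δ (algebraMap B _ b) = algebraMap B _ (D b) := by
  let d : Derivation R (B ⧸ I) (B ⧸ I) :=
    Derivation.liftOfSurjective (f := Ideal.Quotient.mkₐ R I) Ideal.Quotient.mk_surjective
      (d := D) fun b hb =>
        Ideal.Quotient.eq_zero_iff_mem.2 (hD b (Ideal.Quotient.eq_zero_iff_mem.1 hb))
  obtain ⟨δ, hδ⟩ := exists_derivation_extension (nonZeroDivisors (B ⧸ I))
    ((Algebra.linearMap (B ⧸ I) (FractionRing (B ⧸ I))).compDer d)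
  refine ⟨δ, fun b => (hδ (Ideal.Quotient.mk I b)).trans ?_⟩
  exact congrArg (algebraMap (B ⧸ I) (FractionRing (B ⧸ I)))
    (Derivation.liftOfSurjective_apply (f := Ideal.Quotient.mkₐ R I) _ _ b)

/-- Otherwise `lc • d p - d lc • p`, with `d` applied to the coefficients of `p`, would be a
relation of smaller degree. -/
theorem leadingCoeff_mul_derivation_coeff {R A K : Type*} [CommRing R] [CommRing A] [CommRing K]
    [Algebra R A] [Algebra R K] [Algebra A K] {d : Derivation R A A} {δ : Derivation R K K}
    (hδ : ∀ a, δ (algebraMap A K a) = algebraMap A K (d a)) {x : K} (hx : δ x = 0)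
    {p : Polynomial A} (hp : Polynomial.aeval x p = 0)
    (hmin : ∀ q : Polynomial A, Polynomial.aeval x q = 0 → q.degree < p.degree → q = 0) (j : ℕ) :
    p.leadingCoeff * d (p.coeff j) = p.coeff j * d p.leadingCoeff := by
  rcases eq_or_ne p 0 with rfl | hp0
  · simp
  let _ : Differential A := ⟨d.restrictScalars ℤ⟩
  let _ : Differential K := ⟨δ.restrictScalars ℤ⟩
  have _ : DifferentialAlgebra A K := ⟨hδ⟩
  have hx' : x′ = 0 := hx
  have hderiv : Polynomial.aeval x (Differential.mapCoeffs p) = 0 := by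
    simpa [hp, hx'] using (Differential.deriv_aeval_eq x p).symm
  have hzero := hmin (Polynomial.C p.leadingCoeff * Differential.mapCoeffs p -
    Polynomial.C (d p.leadingCoeff) * p) (by simp [hderiv, hp]) <| by
      rw [Polynomial.degree_eq_natDegree hp0, Polynomial.degree_lt_iff_coeff_zero]
      intro m hm
      rw [Polynomial.coeff_sub, Polynomial.coeff_C_mul, Polynomial.coeff_C_mul,
        Differential.coeff_mapCoeffs]
      rcases hm.eq_or_lt with rfl | hlt
      · rw [Polynomial.coeff_natDegree, mul_comm]
        exact sub_self _
      · rw [Polynomial.coeff_eq_zero_of_natDegree_lt hlt]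
        simp
  have hcoeff := congrArg (Polynomial.coeff · j) hzero
  simp only [Polynomial.coeff_sub, Polynomial.coeff_C_mul, Differential.coeff_mapCoeffs,
    Polynomial.coeff_zero] at hcoeff
  rw [mul_comm (p.coeff j)]
  exact sub_eq_zero.1 hcoeff

end derivation

section descent

variable {k A B K ι : Type*} [Field k] [CommRing A] [CommRing B] [Field K] [Algebra k A]
  [Algebra k B] [Algebra k K] [Algebra A B]

/-- A relation of minimal degree has coefficients proportional to constants, so `x` is algebraic
over `k`. -/
theorem exists_algebraMap_eq_of_isAlgebraic [IsAlgClosed k] [Algebra A K] [IsScalarTower k A K]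
    [FaithfulSMul A K] {d : ι → Derivation k A A}
    (hd : ∀ a b, b ≠ 0 → (∀ i, b * d i a = a * d i b) → ∃ c : k, a = c • b)
    {δ : ι → Derivation k K K} (hδ : ∀ i a, δ i (algebraMap A K a) = algebraMap A K (d i a))
    {x : K} (hx : IsAlgebraic A x) (hδx : ∀ i, δ i x = 0) : ∃ c : k, algebraMap k K c = x := by
  obtain ⟨p, ⟨hp0, hpx⟩, hmin⟩ :=
    exists_minimalFor_of_wellFoundedLT _ (Polynomial.degree (R := A)) hx
  have hlc : p.leadingCoeff ≠ 0 := Polynomial.leadingCoeff_ne_zero.2 hp0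
  have hconst : ∀ j, ∃ c : k, p.coeff j = c • p.leadingCoeff := fun j =>
    hd _ _ hlc fun i => leadingCoeff_mul_derivation_coeff (hδ i) (hδx i) hpx
      (fun q hqx hq => by_contra fun hq0 => (hmin ⟨hq0, hqx⟩ hq.le).not_gt hq) j
  choose c hc using hconst
  set q : Polynomial k := ∑ j ∈ Finset.range (p.natDegree + 1), Polynomial.monomial j (c j)
  have hpq : p = Polynomial.C p.leadingCoeff * q.map (algebraMap k A) := by
    conv_lhs => rw [p.as_sum_range]
    rw [Polynomial.map_sum, Finset.mul_sum]
    refine Finset.sum_congr rfl fun j _ => ?_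
    rw [Polynomial.map_monomial, Polynomial.C_mul_monomial, hc j, Algebra.smul_def, mul_comm]
  have hqx : Polynomial.aeval x q = 0 := by
    rw [hpq, map_mul, Polynomial.aeval_C, Polynomial.aeval_map_algebraMap] at hpx
    exact (mul_eq_zero.1 hpx).resolve_left ((FaithfulSMul.algebraMap_eq_zero_iff _ _).not.2 hlc)
  have hq0 : q ≠ 0 := fun h0 => hp0 (by rw [hpq, h0, Polynomial.map_zero, mul_zero])
  have hint : IsIntegral k x := isAlgebraic_iff_isIntegral.1 ⟨q, hq0, hqx⟩
  exact minpoly.mem_range_of_degree_eq_one k x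
    (IsAlgClosed.degree_eq_one_of_irreducible k (minpoly.irreducible hint))

/-- The vector field `D₀π • D₁ - D₁π • D₀` is tangent to the hypersurface `π = 0`. -/
theorem exists_derivation_fractionRing {π : B} [hπ : (Ideal.span {π}).IsPrime]
    {d : Derivation k A A} {D₀ D₁ : Derivation k B B} (hD₀ : ∀ a, D₀ (algebraMap A B a) = 0)
    (hD₁ : ∀ a, D₁ (algebraMap A B a) = algebraMap A B (d a)) (hD₀π : ¬ π ∣ D₀ π) :
    ∃ δ : Derivation k (FractionRing (B ⧸ Ideal.span {π})) (FractionRing (B ⧸ Ideal.span {π})),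
      (∀ a, δ (algebraMap A _ a) = algebraMap A _ (d a)) ∧
      ∀ F G, π ∣ G * D₀ F - F * D₀ G → π ∣ G * D₁ F - F * D₁ G →
        δ (algebraMap B _ F / algebraMap B _ G) = 0 := by
  set K := FractionRing (B ⧸ Ideal.span {π})
  have hker : ∀ b, algebraMap B K b = 0 ↔ π ∣ b := algebraMap_fractionRing_quotient_eq_zero_iff
  let D : Derivation k B B := D₀ π • D₁ - D₁ π • D₀
  have hDapply : ∀ b, D b = D₀ π * D₁ b - D₁ π * D₀ b := fun b => rfl
  obtain ⟨δ, hδ⟩ := exists_derivation_fractionRing_quotient (Ideal.span {π}) (D := D)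
    fun b hb => by
      obtain ⟨q, rfl⟩ := Ideal.mem_span_singleton.1 hb
      refine Ideal.mem_span_singleton.2 ⟨D q, ?_⟩
      rw [Derivation.leibniz, hDapply π, smul_eq_mul, smul_eq_mul]
      ring
  refine ⟨(algebraMap B K (D₀ π))⁻¹ • δ, fun a => ?_, fun F G h₀ h₁ => ?_⟩
  · rw [Derivation.smul_apply, IsScalarTower.algebraMap_apply A B K, hδ, hDapply, hD₀, hD₁,
      mul_zero, sub_zero, map_mul, smul_eq_mul, inv_mul_cancel_left₀ ((hker _).not.2 hD₀π),
      ← IsScalarTower.algebraMap_apply]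
  · have hdvd : π ∣ G * D F - F * D G := by
      rw [show G * D F - F * D G = D₀ π * (G * D₁ F - F * D₁ G) - D₁ π * (G * D₀ F - F * D₀ G) by
        rw [hDapply, hDapply]; ring]
      exact dvd_sub (h₁.mul_left _) (h₀.mul_left _)
    rw [Derivation.smul_apply, Derivation.leibniz_div, hδ, hδ, smul_eq_mul (algebraMap B K G),
      smul_eq_mul (algebraMap B K F), ← map_mul, ← map_mul, ← map_sub, (hker _).2 hdvd, smul_zero,
      smul_zero]

theorem exists_dvd_sub_smul_of_isIntegral [IsAlgClosed k] [IsScalarTower k A B]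
    {π : B} (hπ : Prime π) [Algebra.IsIntegral A (B ⧸ Ideal.span {π})]
    (hA : ∀ a, π ∣ algebraMap A B a → a = 0) {d : ι → Derivation k A A}
    (hd : ∀ a b, b ≠ 0 → (∀ i, b * d i a = a * d i b) → ∃ c : k, a = c • b)
    {D₀ : Derivation k B B} {D : ι → Derivation k B B} (hD₀ : ∀ a, D₀ (algebraMap A B a) = 0)
    (hD : ∀ i a, D i (algebraMap A B a) = algebraMap A B (d i a)) (hD₀π : ¬ π ∣ D₀ π) {F G : B}
    (hG : ¬ π ∣ G) (hW₀ : π ∣ G * D₀ F - F * D₀ G) (hW : ∀ i, π ∣ G * D i F - F * D i G) :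
    ∃ c : k, π ∣ F - c • G := by
  have : (Ideal.span {π}).IsPrime := (Ideal.span_singleton_prime hπ.ne_zero).2 hπ
  set K := FractionRing (B ⧸ Ideal.span {π})
  have hker : ∀ b, algebraMap B K b = 0 ↔ π ∣ b := algebraMap_fractionRing_quotient_eq_zero_iff
  have hinj : Function.Injective (algebraMap A K) :=
    (injective_iff_map_eq_zero _).2 fun a ha => hA a <| (hker _).1 <| by
      rwa [← IsScalarTower.algebraMap_apply]
  have : IsDomain A := hinj.isDomain _
  have : FaithfulSMul A K := (faithfulSMul_iff_algebraMap_injective A K).2 hinj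
  have : Module.IsTorsionFree A K := .trans_faithfulSMul A K K
  have : Algebra.IsAlgebraic A K :=
    (IsFractionRing.isAlgebraic_iff' A (B ⧸ Ideal.span {π}) K).1 inferInstance
  choose δ hδ hδdiv using fun i => exists_derivation_fractionRing hD₀ (hD i) hD₀π
  obtain ⟨c, hc⟩ := exists_algebraMap_eq_of_isAlgebraic hd hδ
    (Algebra.IsAlgebraic.isAlgebraic (algebraMap B K F / algebraMap B K G))
    fun i => hδdiv i F G hW₀ (hW i)
  refine ⟨c, (hker _).1 ?_⟩
  rw [map_sub, Algebra.smul_def, map_mul, ← IsScalarTower.algebraMap_apply k B K, hc,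
    div_mul_cancel₀ _ ((hker _).not.2 hG), sub_self]

end descent

/-! ### Functions constant along an irreducible hypersurface germ -/

section constants

variable {n : ℕ}

/-- The `1`-form `g df - f dg`, the numerator of `d(f / g)`. -/
def wronskian (f g : convSeries n) : OneForm n := g • diff f - f • diff g

theorem wronskian_apply (f g : convSeries n) (k : Fin n) :
    wronskian f g k = g * pd k f - f * pd k g :=
  rfl

theorem dividesForm_iff {a : convSeries n} {ω : OneForm n} :
    DividesForm a ω ↔ ∀ k, a ∣ ω k := by
  refine ⟨?_, fun h => ?_⟩
  · rintro ⟨η, rfl⟩ k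
    exact Dvd.intro (η k) rfl
  · choose η hη using h
    exact ⟨η, funext hη⟩

theorem isUnit_natCast {m : ℕ} (hm : m ≠ 0) : IsUnit (m : convSeries n) := by
  rw [← map_natCast (algebraMap ℂ (convSeries n))]
  exact (IsUnit.mk0 (m : ℂ) (Nat.cast_ne_zero.2 hm)).map _

instance : IsAddTorsionFree (convSeries n) where
  nsmul_right_injective m hm a b hab := by
    simp only [nsmul_eq_mul] at hab
    exact (isUnit_natCast hm).mul_left_cancel hab

/-- Some derivative has smaller order than `b`. -/
theorem exists_not_dvd_pd {b : convSeries n} (hb : b ≠ 0) (hu : ¬ IsUnit b) :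
    ∃ k, ¬ b ∣ pd k b := by
  have hb' : (b : MvPowerSeries (Fin n) ℂ) ≠ 0 := fun h0 => hb (Subtype.ext h0)
  obtain ⟨m, hm, hdeg⟩ := exists_coeff_ne_zero_and_order (ne_zero_iff_order_finite.1 hb')
  have hm0 : m ≠ 0 := by
    rintro rfl
    exact hu ((isUnit_iff b).2 hm)
  obtain ⟨k, hk⟩ := Finsupp.ne_iff.1 hm0
  obtain ⟨m', rfl⟩ := exists_add_of_le
    (show Finsupp.single k 1 ≤ m by simpa using Nat.one_le_iff_ne_zero.2 hk)
  refine ⟨k, fun ⟨q, hq⟩ => ?_⟩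
  have hcoeff : coeff m' (pd k b : MvPowerSeries (Fin n) ℂ) ≠ 0 := by
    change coeff m' (MvPowerSeries.pderiv ℂ k (b : MvPowerSeries (Fin n) ℂ)) ≠ 0
    rw [coeff_pderiv, add_comm m']
    exact mul_ne_zero hm (Nat.cast_add_one_ne_zero _)
  refine hcoeff (coeff_of_lt_order ?_)
  rw [hq, MulMemClass.coe_mul, order_mul, ← hdeg, map_add, Finsupp.degree_single]
  refine lt_of_lt_of_le ?_ le_self_add
  exact_mod_cast (by lia : m'.degree < 1 + m'.degree)

theorem eq_algebraMap_of_pd_eq_zero {e : convSeries n} (he : ∀ k, pd k e = 0) :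
    e = algebraMap ℂ (convSeries n) (constantCoeff (e : MvPowerSeries (Fin n) ℂ)) := by
  refine Subtype.ext (MvPowerSeries.pderiv.ext (fun k => ?_) (constantCoeff_C _).symm)
  exact (congrArg Subtype.val (he k)).trans (pderiv_C (R := ℂ)).symm

/-- In lowest terms the denominator divides all its derivatives, so it is a unit. -/
theorem exists_eq_smul_of_pd_eq {a b : convSeries n} (hb : b ≠ 0)
    (h : ∀ k, b * pd k a = a * pd k b) : ∃ c : ℂ, a = c • b := by
  obtain ⟨b', a', d, hrel, rfl, rfl⟩ := UniqueFactorizationMonoid.exists_reduced_factors b hb a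
  have hd : d ≠ 0 := left_ne_zero_of_mul hb
  have hb' : b' ≠ 0 := right_ne_zero_of_mul hb
  have hreduced : ∀ k, b' * pd k a' = a' * pd k b' := fun k => by
    have hk := h k
    simp only [Derivation.leibniz, smul_eq_mul] at hk
    refine mul_left_cancel₀ (mul_ne_zero hd hd) ?_
    linear_combination hk
  have hunit : IsUnit b' := by
    by_contra hu
    obtain ⟨k, hk⟩ := exists_not_dvd_pd hb' hu
    exact hk (hrel.dvd_of_dvd_mul_left (Dvd.intro _ (hreduced k)))
  obtain ⟨e, rfl⟩ := hunit.dvd (a := a')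
  have he : ∀ k, pd k e = 0 := fun k => by
    have hk := hreduced k
    simp only [Derivation.leibniz, smul_eq_mul] at hk
    refine mul_left_cancel₀ (mul_ne_zero hb' hb') ?_
    linear_combination hk
  refine ⟨constantCoeff (e : MvPowerSeries (Fin n) ℂ), ?_⟩
  rw [Algebra.smul_def, ← eq_algebraMap_of_pd_eq_zero he]
  ring

end constants

section weierstrass

variable {n : ℕ} {P : Polynomial (convSeries n)}

theorem IsWeierstrass.eq_zero_of_dvd_lift (hP : IsWeierstrass P) (hd : P.natDegree ≠ 0)
    {a : convSeries n} (hdvd : polyMap P ∣ lift a) : a = 0 := by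
  have hdeg : (Polynomial.C a).degree < P.degree := Polynomial.degree_C_le.trans_lt
    (Polynomial.natDegree_pos_iff_degree_pos.1 (Nat.pos_of_ne_zero hd))
  rw [← polyMap_C] at hdvd
  exact Polynomial.C_eq_zero.1 (hP.eq_zero_of_dvd hdeg hdvd)

theorem IsWeierstrass.not_dvd_pd_zero (hP : IsWeierstrass P) (hd : P.natDegree ≠ 0) :
    ¬ polyMap P ∣ pd 0 (polyMap P) := fun hdvd => by
  rw [pd_zero_polyMap] at hdvd
  have hderiv := hP.eq_zero_of_dvd (Polynomial.degree_derivative_lt hP.1.ne_zero) hdvd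
  exact hd (Polynomial.derivative_eq_zero.1 hderiv)

theorem IsWeierstrass.exists_dvd_sub_smul (hP : IsWeierstrass P) (hirr : Irreducible (polyMap P))
    {F G : convSeries (n + 1)} (hG : ¬ polyMap P ∣ G)
    (hW : DividesForm (polyMap P) (wronskian F G)) : ∃ c : ℂ, polyMap P ∣ F - c • G := by
  rw [dividesForm_iff] at hW
  have hd := hP.natDegree_ne_zero hirr.not_isUnit
  have := hP.isIntegral
  exact exists_dvd_sub_smul_of_isIntegral (hP.prime hirr) (fun a => hP.eq_zero_of_dvd_lift hd)
    (fun a b hb => exists_eq_smul_of_pd_eq hb) pd_zero_lift (fun k => pd_succ_lift k)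
    (hP.not_dvd_pd_zero hd) hG (hW 0) fun k => hW k.succ

end weierstrass

theorem wronskian_linEquiv {n p : ℕ} (A : (Fin n → ℂ) ≃ₗ[ℂ] (Fin p → ℂ)) (f g : convSeries p)
    (k : Fin n) : wronskian (linEquiv A f) (linEquiv A g) k =
      ∑ j, A (Pi.single k 1) j • linEquiv A (wronskian f g j) := by
  simp only [wronskian_apply, pd_linEquiv, Finset.mul_sum, ← Finset.sum_sub_distrib, map_sub,
    map_mul, smul_sub, mul_smul_comm]

theorem exists_dvd_sub_smul {n : ℕ} {h f g : convSeries n} (hh : Irreducible h) (hg : ¬ h ∣ g)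
    (hW : DividesForm h (wronskian f g)) : ∃ c : ℂ, h ∣ f - c • g := by
  cases n with
  | zero => exact (not_irreducible_of_isEmpty h hh).elim
  | succ n =>
    obtain ⟨A, P, hP, hPh⟩ := exists_linEquiv_isWeierstrass hh.ne_zero hh.not_isUnit
    have hdvd : ∀ a, polyMap P ∣ linEquiv A.toLinearEquiv a ↔ h ∣ a := fun a => by
      rw [← hPh.dvd_iff_dvd_left]
      exact map_dvd_iff (linEquiv A.toLinearEquiv)
    have hirr : Irreducible (polyMap P) :=
      hPh.irreducible_iff.1 ((MulEquiv.irreducible_iff (linEquiv A.toLinearEquiv)).2 hh)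
    obtain ⟨c, hc⟩ := hP.exists_dvd_sub_smul hirr ((hdvd g).not.2 hg) (F := linEquiv _ f) <|
      dividesForm_iff.2 fun k => by
        rw [wronskian_linEquiv]
        exact Finset.dvd_sum fun j _ => dvd_smul_of_dvd _ ((hdvd _).2 (dividesForm_iff.1 hW j))
    exact ⟨c, (hdvd _).1 (by rwa [map_sub, map_smul])⟩

/-! ### Hypersurface components of analytic germs -/

section components

variable {n : ℕ} {X Y : Set (Fin n → ℂ)} {S T : Set (convSeries n)}

theorem le_zeros_iff (hS : S.Finite) : X ≤ᶠ[𝓝 0] zeros S ↔ S ⊆ vanishingIdeal X := by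
  have hsubset : S ⊆ vanishingIdeal X ↔ ∀ a ∈ S, ∀ᶠ z in 𝓝 0, z ∈ X → value a z = 0 :=
    forall₂_congr fun a _ => eventually_congr <| .of_forall fun z =>
      imp_congr_right fun _ => mem_zeros_singleton
  rw [hsubset, ← eventually_all_finite hS]
  exact eventually_congr <| .of_forall fun z =>
    ⟨fun h a ha hz => h hz a ha, fun h hz a ha => h a ha hz⟩

theorem zeros_union : zeros (S ∪ T) = zeros S ∩ zeros T :=
  Set.ext fun z => by simp only [zeros, Set.mem_union, or_imp, forall_and, Set.mem_inter_iff,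
    Set.mem_ofPred_eq]

theorem isAnalyticGerm_zeros (hS : S.Finite) : IsAnalyticGerm (zeros S) :=
  ⟨S, hS, .rfl⟩

theorem IsAnalyticGerm.inter (hX : IsAnalyticGerm X) (hY : IsAnalyticGerm Y) :
    IsAnalyticGerm (X ∩ Y) := by
  obtain ⟨S, hS, hXS⟩ := hX
  obtain ⟨T, hT, hYT⟩ := hY
  exact ⟨S ∪ T, hS.union hT, zeros_union ▸ hXS.inter hYT⟩

theorem IsAnalyticGerm.le_iff (hY : IsAnalyticGerm Y) :
    X ≤ᶠ[𝓝 0] Y ↔ vanishingIdeal Y ≤ vanishingIdeal X := by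
  refine ⟨vanishingIdeal_anti, fun h => ?_⟩
  obtain ⟨S, hS, hYS⟩ := hY
  exact ((le_zeros_iff hS).2 (((le_zeros_iff hS).1 hYS.le).trans h)).trans hYS.symm.le

theorem vanishingIdeal_inf_le_union :
    vanishingIdeal X ⊓ vanishingIdeal Y ≤ vanishingIdeal (X ∪ Y) := fun f ⟨hX, hY⟩ => by
  filter_upwards [hX, hY] with z hXz hYz hz
  exact hz.elim hXz hYz

theorem vanishingIdeal_eq_top_iff : vanishingIdeal X = ⊤ ↔ X =ᶠ[𝓝 0] (∅ : Set (Fin n → ℂ)) := by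
  rw [Ideal.eq_top_iff_one, mem_vanishingIdeal, eventuallyEq_empty]
  refine eventually_congr <| .of_forall fun z => ?_
  change (z ∈ X → z ∈ zeros {1}) ↔ z ∉ X
  rw [mem_zeros_singleton, value_one]
  exact imp_congr_right fun _ => iff_false_intro one_ne_zero

theorem IsIrreducibleGerm.isPrime_vanishingIdeal (hX : IsIrreducibleGerm X) :
    (vanishingIdeal X).IsPrime := by
  obtain ⟨hanalytic, hne, hirr⟩ := hX
  refine ⟨vanishingIdeal_eq_top_iff.not.2 hne, fun {a b} hab => ?_⟩
  have hinter (a : convSeries n) : IsAnalyticGerm (X ∩ zeros {a}) :=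
    hanalytic.inter (isAnalyticGerm_zeros (Set.finite_singleton a))
  have hle {a : convSeries n} (h : X =ᶠ[𝓝 0] (X ∩ zeros {a} : Set (Fin n → ℂ))) :
      a ∈ vanishingIdeal X :=
    h.le.trans (.of_forall fun _ => And.right)
  refine (hirr _ _ (hinter a) (hinter b) (EventuallyLE.antisymm ?_ ?_)).imp hle hle
  · filter_upwards [hab, eventually_value_mul a b] with z habz hmul hz
    rw [← Set.inter_union_distrib_left]
    refine ⟨hz, ?_⟩
    rw [Set.mem_union, mem_zeros_singleton, mem_zeros_singleton, ← mul_eq_zero, ← hmul]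
    exact mem_zeros_singleton.1 (habz hz)
  · exact .of_forall fun z hz => hz.elim And.left And.left

theorem IsAnalyticGerm.isIrreducibleGerm (hX : IsAnalyticGerm X)
    (hprime : (vanishingIdeal X).IsPrime) : IsIrreducibleGerm X := by
  refine ⟨hX, vanishingIdeal_eq_top_iff.not.1 hprime.ne_top, fun Y Z hY hZ hXYZ => ?_⟩
  have hle : vanishingIdeal Y ⊓ vanishingIdeal Z ≤ vanishingIdeal X :=
    vanishingIdeal_inf_le_union.trans (vanishingIdeal_anti hXYZ.le)
  refine (hprime.inf_le.1 hle).imp (fun h => (hY.le_iff.2 h).antisymm ?_)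
    fun h => (hZ.le_iff.2 h).antisymm ?_
  · exact EventuallyLE.trans (.of_forall fun _ => Or.inl) hXYZ.symm.le
  · exact EventuallyLE.trans (.of_forall fun _ => Or.inr) hXYZ.symm.le

theorem isIrreducibleGerm_zeros {h : convSeries n} (hh : Irreducible h) :
    IsIrreducibleGerm (zeros {h}) := by
  refine (isAnalyticGerm_zeros (Set.finite_singleton h)).isIrreducibleGerm ?_
  rw [vanishingIdeal_zeros hh, Ideal.span_singleton_prime hh.ne_zero]
  exact UniqueFactorizationMonoid.irreducible_iff_prime.1 hh

theorem eq_span_singleton_of_isPrime_of_le {R : Type*} [CommRing R] [WfDvdMonoid R] {h : R}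
    (hu : ¬ IsUnit h) {I : Ideal R} (hI : I.IsPrime) (h0 : I ≠ ⊥)
    (hle : I ≤ Ideal.span {h}) : I = Ideal.span {h} := by
  obtain ⟨a, ha, ha0⟩ := Submodule.exists_mem_ne_zero_of_ne_bot h0
  obtain ⟨m, b, hb, rfl⟩ := WfDvdMonoid.max_power_factor' ha0 hu
  have hbI : b ∉ I := fun hbI => hb (Ideal.mem_span_singleton.1 (hle hbI))
  have hhI : h ∈ I := hI.mem_of_pow_mem m ((hI.mem_or_mem ha).resolve_right hbI)
  exact hle.antisymm ((Ideal.span_singleton_le_iff_mem _).2 hhI)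

theorem isComponent_zeros_sing {h : convSeries n} (hh : Irreducible h) {ω : OneForm n}
    (hω : ω ≠ 0) (hdvd : DividesForm h ω) : IsComponent (zeros {h}) (sing ω) := by
  have hrange : (Set.range ω).Finite := Set.finite_range ω
  refine ⟨isIrreducibleGerm_zeros hh, ?_, fun W hW hhW hWω => EventuallyLE.antisymm ?_ hhW⟩
  · refine (le_zeros_iff hrange).2 (Set.range_subset_iff.2 fun k => ?_)
    exact zeros_le_zeros_of_dvd (dividesForm_iff.1 hdvd k)
  · obtain ⟨k, hk⟩ := Function.ne_iff.1 hω
    have hmem : ω k ∈ vanishingIdeal W := (le_zeros_iff hrange).1 hWω ⟨k, rfl⟩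
    have hle : vanishingIdeal W ≤ Ideal.span {h} :=
      vanishingIdeal_zeros hh ▸ vanishingIdeal_anti hhW
    have heq := eq_span_singleton_of_isPrime_of_le hh.not_isUnit hW.isPrime_vanishingIdeal
      (Submodule.ne_bot_iff _ |>.2 ⟨ω k, hmem, hk⟩) hle
    exact (heq ▸ Ideal.mem_span_singleton_self h : h ∈ vanishingIdeal W)

end components

/-! ### Divisors of the reduced logarithmic differential -/

section theta

variable {n : ℕ} {f g h : convSeries n}

theorem DividesForm.of_dvd {a b : convSeries n} {ω : OneForm n} (hab : a ∣ b)
    (hb : DividesForm b ω) : DividesForm a ω :=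
  dividesForm_iff.2 fun k => hab.trans (dividesForm_iff.1 hb k)

theorem dividesForm_zero (a : convSeries n) : DividesForm a (0 : OneForm n) :=
  ⟨0, (smul_zero a).symm⟩

namespace Decomposition

variable (D : Decomposition f)

theorem red_dvd : D.red ∣ f := by
  have hprod : D.red ∣ ∏ i, D.factor i ^ D.exponent i :=
    Finset.prod_dvd_prod_of_dvd _ _ fun i _ => dvd_pow_self _ (D.exponent_pos i).ne'
  exact hprod.trans (Dvd.intro_left _ D.eq_prod.symm)

theorem factor_dvd_red (i : Fin D.len) : D.factor i ∣ D.red :=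
  Finset.dvd_prod_of_mem _ (Finset.mem_univ i)

theorem exists_associated_factor (hh : Prime h) (hf : h ∣ f) :
    ∃ i, Associated h (D.factor i) := by
  rw [D.eq_prod, D.unit.isUnit.dvd_mul_left, hh.dvd_finsetProd_iff] at hf
  obtain ⟨i, -, hi⟩ := hf
  exact ⟨i, hh.irreducible.associated_of_dvd (D.irreducible i) (hh.dvd_of_dvd_pow hi)⟩

theorem prime_factor (i : Fin D.len) : Prime (D.factor i) :=
  UniqueFactorizationMonoid.irreducible_iff_prime.1 (D.irreducible i)

theorem not_factor_dvd_prod_erase (i : Fin D.len) :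
    ¬ D.factor i ∣ ∏ j ∈ Finset.univ.erase i, D.factor j := by
  rw [(D.prime_factor i).dvd_finsetProd_iff]
  rintro ⟨j, hj, hij⟩
  exact D.not_associated i j (Finset.ne_of_mem_erase hj).symm
    ((D.irreducible i).associated_of_dvd (D.irreducible j) hij)

/-- Modulo `fᵢ`, the form `f^red df / f` reduces to `nᵢ f₁ ⋯ (omit fᵢ) ⋯ f_α dfᵢ`. -/
theorem exists_not_factor_dvd_redLogDiff (i : Fin D.len) :
    ∃ k, ¬ D.factor i ∣ D.redLogDiff k := by
  obtain ⟨k, hk⟩ := exists_not_dvd_pd (D.irreducible i).ne_zero (D.irreducible i).not_isUnit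
  have hsum : D.redLogDiff k =
      D.red * (D.unit⁻¹ : (convSeries n)ˣ) * pd k (D.unit : convSeries n) +
        ∑ j, (D.exponent j : convSeries n) * (∏ l ∈ Finset.univ.erase j, D.factor l) *
          pd k (D.factor j) := by
    simp [redLogDiff, diff]
  have hothers : D.factor i ∣ ∑ j ∈ Finset.univ.erase i, (D.exponent j : convSeries n) *
      (∏ l ∈ Finset.univ.erase j, D.factor l) * pd k (D.factor j) :=
    Finset.dvd_sum fun j hj => ((Finset.dvd_prod_of_mem _ (Finset.mem_erase.2
      ⟨(Finset.ne_of_mem_erase hj).symm, Finset.mem_univ i⟩)).mul_left _).mul_right _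
  refine ⟨k, ?_⟩
  rw [hsum, dvd_add_right (((D.factor_dvd_red i).mul_right _).mul_right _),
    ← Finset.add_sum_erase _ _ (Finset.mem_univ i), dvd_add_left hothers, mul_assoc,
    (isUnit_natCast (D.exponent_pos i).ne').dvd_mul_left]
  exact (D.prime_factor i).not_dvd_mul (D.not_factor_dvd_prod_erase i) hk

end Decomposition

variable (Df : Decomposition f) (Dg : Decomposition g)

theorem theta_swap : theta Dg Df = -theta Df Dg :=
  (neg_sub _ _).symm

theorem not_dvd_left_of_dividesForm_theta (hfg : IsRelPrime f g) (hh : Prime h)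
    (hθ : DividesForm h (theta Df Dg)) : ¬ h ∣ f := fun hf => by
  obtain ⟨i, hi⟩ := Df.exists_associated_factor hh hf
  obtain ⟨k, hk⟩ := Df.exists_not_factor_dvd_redLogDiff i
  have hred : h ∣ Df.red := hi.dvd.trans (Df.factor_dvd_red i)
  have hk' : h ∣ Dg.red * Df.redLogDiff k :=
    (dvd_sub_left (hred.mul_right (Dg.redLogDiff k))).1 (dividesForm_iff.1 hθ k)
  rcases hh.dvd_or_dvd hk' with hg | hlog
  · exact hh.not_isUnit (hfg hf (hg.trans Dg.red_dvd))
  · exact hk (hi.symm.dvd.trans hlog)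

theorem not_dvd_of_dividesForm_theta (hfg : IsRelPrime f g) (hh : Prime h)
    (hθ : DividesForm h (theta Df Dg)) : ¬ h ∣ f ∧ ¬ h ∣ g := by
  refine ⟨not_dvd_left_of_dividesForm_theta Df Dg hfg hh hθ,
    not_dvd_left_of_dividesForm_theta Dg Df hfg.symm hh ?_⟩
  rw [theta_swap Df Dg, dividesForm_iff]
  exact fun k => (dividesForm_iff.1 hθ k).neg_right

theorem dividesForm_pow_theta_iff (hh : Prime h) (hf : ¬ h ∣ f) (hg : ¬ h ∣ g) (m : ℕ) :
    DividesForm (h ^ m) (theta Df Dg) ↔ DividesForm (h ^ m) (wronskian f g) := by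
  have hθ (k : Fin n) : f * g * theta Df Dg k = Df.red * Dg.red * wronskian f g k :=
    congrFun (mul_theta Df Dg) k
  have hprod : ¬ h ∣ f * g := hh.not_dvd_mul hf hg
  have hred : ¬ h ∣ Df.red * Dg.red := fun hdvd =>
    hprod (hdvd.trans (mul_dvd_mul Df.red_dvd Dg.red_dvd))
  rw [dividesForm_iff, dividesForm_iff]
  refine forall_congr' fun k => ⟨fun hdvd => ?_, fun hdvd => ?_⟩
  · exact hh.pow_dvd_of_dvd_mul_left m hred (hθ k ▸ hdvd.mul_left _)
  · exact hh.pow_dvd_of_dvd_mul_left m hprod (hθ k ▸ hdvd.mul_left _)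

end theta

/-! ### Divisors of the Wronskian -/

section wronskian

variable {n : ℕ} {f g h : convSeries n} {c : ℂ}

theorem wronskian_sub_smul : wronskian (f - c • g) g = wronskian f g := by
  funext k
  simp only [wronskian_apply, map_sub, Derivation.map_smul]
  simp only [Algebra.smul_def]
  ring

theorem wronskian_pow_mul (j : ℕ) (e : convSeries n) (k : Fin n) :
    wronskian (h ^ (j + 1) * e) g k =
      h ^ j * (((j + 1 : ℕ) : convSeries n) * (g * e * pd k h) + h * wronskian e g k) := by
  simp only [wronskian_apply, Derivation.leibniz, Derivation.leibniz_pow, smul_eq_mul,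
    nsmul_eq_mul, Nat.add_sub_cancel]
  ring

theorem dividesForm_pow_wronskian_iff (hh : Prime h) (hg : ¬ h ∣ g) {j : ℕ}
    (hj : emultiplicity h (f - c • g) = (j + 1 : ℕ)) (m : ℕ) :
    DividesForm (h ^ m) (wronskian f g) ↔ m ≤ j := by
  obtain ⟨⟨e, hfe⟩, hmax⟩ := emultiplicity_eq_coe.1 hj
  have he : ¬ h ∣ e := fun hdvd => hmax (by rw [hfe, pow_succ h (j + 1)]; gcongr)
  rw [← wronskian_sub_smul (c := c), hfe]
  refine ⟨fun hm => not_lt.1 fun hjm => ?_, fun hmj => dividesForm_iff.2 fun k => ?_⟩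
  · obtain ⟨k, hk⟩ := exists_not_dvd_pd hh.ne_zero hh.not_isUnit
    have hdvd := dividesForm_iff.1 (hm.of_dvd (pow_dvd_pow h hjm)) k
    rw [wronskian_pow_mul, Nat.succ_eq_add_one, pow_succ,
      mul_dvd_mul_iff_left (pow_ne_zero j hh.ne_zero), dvd_add_left (dvd_mul_right h _),
      (isUnit_natCast j.succ_ne_zero).dvd_mul_left] at hdvd
    exact hh.not_dvd_mul (hh.not_dvd_mul hg he) hk hdvd
  · rw [wronskian_pow_mul]
    exact (pow_dvd_pow h hmj).mul_right _

theorem exists_emultiplicity_sub_smul (hh : Irreducible h) (hf : ¬ h ∣ f) (hg : ¬ h ∣ g)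
    (hne : wronskian f g ≠ 0) (hW : DividesForm h (wronskian f g)) :
    ∃ c : ℂ, c ≠ 0 ∧ ∃ j : ℕ, emultiplicity h (f - c • g) = (j + 1 : ℕ) := by
  obtain ⟨c, hc⟩ := exists_dvd_sub_smul hh hg hW
  have hsub : f - c • g ≠ 0 := fun hzero => hne <| by
    rw [← wronskian_sub_smul (c := c), hzero]
    funext k
    simp [wronskian_apply]
  have hfin : FiniteMultiplicity h (f - c • g) := .of_not_isUnit hh.not_isUnit hsub
  refine ⟨c, ?_, multiplicity h (f - c • g) - 1, ?_⟩
  · rintro rfl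
    exact hf (by rwa [zero_smul, sub_zero] at hc)
  · rw [hfin.emultiplicity_eq_multiplicity,
      Nat.sub_add_cancel (multiplicity_pos_of_dvd hc)]

theorem not_dvd_of_dvd_sub_smul (hfg : IsRelPrime f g) (hh : Prime h) (hc : c ≠ 0)
    (hd : h ∣ f - c • g) : ¬ h ∣ f ∧ ¬ h ∣ g := by
  have hiff : h ∣ f ↔ h ∣ g := by
    rw [dvd_iff_dvd_of_dvd_sub hd, Algebra.smul_def,
      ((IsUnit.mk0 c hc).map (algebraMap ℂ (convSeries n))).dvd_mul_left]
  exact ⟨fun hf => hh.not_isUnit (hfg hf (hiff.1 hf)),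
    fun hg => hh.not_isUnit (hfg (hiff.2 hg) hg)⟩

end wronskian

end ConvSeries

end

theorem mainTheorem2 {n : ℕ} {f g : ConvSeries.convSeries n} (hfg : IsRelPrime f g)
    (Df : ConvSeries.Decomposition f) (Dg : ConvSeries.Decomposition g)
    (h : ConvSeries.convSeries n) (hh : Irreducible h) (ℓ : ℕ) (hℓ : 1 ≤ ℓ) :
    ConvSeries.IsSingComponent (ConvSeries.theta Df Dg) h ℓ ↔
      ∃ c : ℂ, c ≠ 0 ∧ emultiplicity h (f - c • g) = ((ℓ + 1 : ℕ) : ℕ∞) := by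
  open ConvSeries in
  have hp : Prime h := UniqueFactorizationMonoid.irreducible_iff_prime.1 hh
  constructor
  · rintro ⟨-, -, hdvd, hmax⟩
    have hθ : DividesForm h (theta Df Dg) := hdvd.of_dvd (dvd_pow_self h (by lia))
    obtain ⟨hf, hg⟩ := not_dvd_of_dividesForm_theta Df Dg hfg hp hθ
    rw [dividesForm_pow_theta_iff Df Dg hp hf hg] at hdvd hmax
    have hne : wronskian f g ≠ 0 := fun hzero => hmax (hzero ▸ dividesForm_zero _)
    obtain ⟨c, hc, j, hj⟩ := exists_emultiplicity_sub_smul hh hf hg hne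
      (hdvd.of_dvd (dvd_pow_self h (by lia)))
    rw [dividesForm_pow_wronskian_iff hp hg hj] at hdvd hmax
    obtain rfl : j = ℓ := by lia
    exact ⟨c, hc, hj⟩
  · rintro ⟨c, hc, hℓc⟩
    obtain ⟨hf, hg⟩ := not_dvd_of_dvd_sub_smul hfg hp hc
      (dvd_of_emultiplicity_pos (by rw [hℓc]; exact_mod_cast ℓ.succ_pos))
    have hiff (m : ℕ) : DividesForm (h ^ m) (theta Df Dg) ↔ m ≤ ℓ :=
      (dividesForm_pow_theta_iff Df Dg hp hf hg m).trans (dividesForm_pow_wronskian_iff hp hg hℓc m)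
    have hne : theta Df Dg ≠ 0 := fun hzero =>
      ℓ.not_succ_le_self ((hiff (ℓ + 1)).1 (hzero ▸ dividesForm_zero _))
    have hθ : DividesForm h (theta Df Dg) := pow_one h ▸ (hiff 1).2 hℓ
    exact ⟨hh, isComponent_zeros_sing hh hne hθ, (hiff ℓ).2 le_rfl,
      mt (hiff (ℓ + 1)).1 ℓ.not_succ_le_self⟩
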